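/- Let $\sigma=(\sigma(x))_{x\ge 0}$ be a potentially killed subordinator on a probability space: there are a conservative subordinator $\sigma^{\vartriangle}$ (a real-valued process with stationary independent increments and almost surely nondecreasing, right-continuous paths started at $0$) and an independent exponential time $\mathbf e_q$ of parameter $q\ge 0$ ($\mathbf e_0=\infty$) such that $\sigma(x)=\sigma^{\vartriangle}(x)$ for $x<\mathbf e_q$ and $\sigma(x)=\infty$ for $x\ge \mathbf e_q$. Let $\Phi$ be its Laplace exponent, with drift $\mathfrak b\ge 0$ and Lévy measure $\mu_\Phi$, i.e. $$\mathbb E\big[e^{-z\sigma(1)}\big]=e^{-\Phi(z)},\qquad \Phi(z)=q+\mathfrak b z+\int_{(0,\infty)}(1-e^{-zy})\,\mu_\Phi(dy),\qquad \Re z\ge 0,$$ where $e^{-z\cdot\infty}=0$ and $\mu_\Phi$ is a measure on $(0,\infty)$ with $\int\min\{y,1\}\,\mu_\Phi(dy)<\infty$. Let $\bar\mu_\Phi(t)=\mu_\Phi((t,\infty))$ be its tail, and let $\bar\mu_\Phi^{*1}=\bar\mu_\Phi$ and $\bar\mu_\Phi^{*n}(t)=\int_0^t\bar\mu_\Phi(s)\,\bar\mu_\Phi^{*(n-1)}(t-s)\,ds$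 for $n\ge 2$. Put $$\mathbb D=\{(x,t)\in\mathbb R^2:\ t>0,\ 0<x<t/\mathfrak b\}\quad (t/0=\infty),\qquad f_\Phi(x,t)=\int_{[0,t]}\bar\mu_\Phi(t-y)\,\mathbb P(\sigma(x)\in dy),\quad (x,t)\in\mathbb D,$$ and $f_\Phi=0$ outside $\mathbb D$. Suppose that for some $\theta\in(0,\pi)$ the function $\Phi$ extends to a function that is holomorphic on the sector $\{z\neq 0:\ |\operatorname{Arg} z|<\pi-\theta/2\}$ and continuous on its closure, and that for this extension $\Phi(z)/z\to\mathfrak b$ as $|z|\to\infty$, uniformly in the closed sector. Then, for every $n\ge 1$, the convolution power $\bar\mu_\Phi^{*n}$ is finite and $C^\infty$ on $(0,\infty)$; moreover $f_\Phi$ is finite and $C^\infty$ on $\mathbb D$ (jointly in $(x,t)$). -/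

import Mathlib

open MeasureTheory ProbabilityTheory Set Filter Topology
open scoped NNReal ENNReal

noncomputable section

namespace InvSubord

/-- A Lévy measure of a subordinator: a measure carried by `(0, ∞)` with `∫ min {y, 1} μ(dy) < ∞`.
Such a measure is automatically finite on `[ε, ∞)` for every `ε > 0`. -/
structure IsLevyMeasure (μ : Measure ℝ) : Prop where
  carrier : μ (Iic 0) = 0
  integrable_min : ∫⁻ y, ENNReal.ofReal (min y 1) ∂μ < ∞

/-- The Bernstein function `Φ(z) = q + b z + ∫ (1 - e^{-z y}) μ(dy)`, for `Re z ≥ 0`. -/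
def bernsteinFn (q b : ℝ) (μ : Measure ℝ) (z : ℂ) : ℂ :=
  (q : ℂ) + (b : ℂ) * z + ∫ y, (1 - Complex.exp (-(z * (y : ℂ)))) ∂μ

/-- The tail `μ̄(t) = μ((t, ∞))`, for `t ≥ 0`; finite for `t > 0`, possibly infinite at `t = 0`. -/
def levyTail (μ : Measure ℝ) (t : ℝ) : ℝ≥0∞ := μ (Ioi t)

/-- The convolution `(f * g)(t) = ∫_0^t f(s) g(t - s) ds` of nonnegative functions on `[0, ∞)`. -/
def conv (f g : ℝ → ℝ≥0∞) (t : ℝ) : ℝ≥0∞ := ∫⁻ s in Icc 0 t, f s * g (t - s)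

/-- Convolution powers: `f^{*1} = f` and `f^{*n} = f * f^{*(n-1)}` for `n ≥ 2`. The power `0` is
the Dirac mass at `0`, which is not a function; the value given to it here is never used. -/
def convPow (f : ℝ → ℝ≥0∞) : ℕ → ℝ → ℝ≥0∞
  | 0 => fun _ => 0
  | 1 => f
  | n + 2 => conv f (convPow f (n + 1))

variable {Ω : Type*} [MeasurableSpace Ω]

/-- A conservative subordinator: a real-valued process with stationary independent increments whose
paths almost surely start at `0`, are nondecreasing and right-continuous (left limits then exist by
monotonicity). -/
structure IsSubordinator (P : Measure Ω) (S : ℝ≥0 → Ω → ℝ) : Prop where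
  measurable : ∀ x, Measurable (S x)
  zero : ∀ᵐ ω ∂P, S 0 ω = 0
  monotone : ∀ᵐ ω ∂P, Monotone fun x => S x ω
  rightContinuous : ∀ᵐ ω ∂P, ∀ x, ContinuousWithinAt (fun y => S y ω) (Ici x) x
  indepIncrements : HasIndepIncrements S P
  stationary : ∀ x h : ℝ≥0, IdentDistrib (fun ω => S (x + h) ω - S x ω) (S h) P P

/-- `σ` is a subordinator killed at rate `q`: there are a conservative subordinator `S` and an
independent exponential time `e` of parameter `q` (so that `e = ∞` almost surely when `q = 0`) with
`σ(x) = S(x)` for `x < e` and `σ(x) = ∞` for `x ≥ e`. -/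
def IsKilledSubordinator (P : Measure Ω) (σ : ℝ≥0 → Ω → ℝ≥0∞) (q : ℝ) : Prop :=
  ∃ (S : ℝ≥0 → Ω → ℝ) (e : Ω → ℝ≥0∞),
    IsSubordinator P S ∧
    Measurable e ∧
    (∀ x : ℝ≥0, P {ω | (x : ℝ≥0∞) < e ω} = ENNReal.ofReal (Real.exp (-(q * x)))) ∧
    IndepFun (fun ω (x : ℝ≥0) => S x ω) e P ∧
    ∀ (x : ℝ≥0) (ω : Ω),
      ((x : ℝ≥0∞) < e ω → σ x ω = ENNReal.ofReal (S x ω)) ∧ (e ω ≤ (x : ℝ≥0∞) → σ x ω = ∞)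

/-- `Φ` is the Laplace exponent of `σ`: `E[e^{-z σ(1)}] = e^{-Φ(z)}` for `Re z ≥ 0`, where
`e^{-z ∞} = 0`. -/
def HasLaplaceExponent (P : Measure Ω) (σ : ℝ≥0 → Ω → ℝ≥0∞) (Φ : ℂ → ℂ) : Prop :=
  ∀ z : ℂ, 0 ≤ z.re →
    ∫ ω in {ω | σ 1 ω ≠ ∞}, Complex.exp (-(z * ((σ 1 ω).toReal : ℂ))) ∂P = Complex.exp (-Φ z)

/-- The region of the pairs `(x, t)` with `t > 0` and `0 < x < t / b`, where `t / 0 = ∞`. -/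
def region (b : ℝ) : Set (ℝ × ℝ) := {p | 0 < p.2 ∧ 0 < p.1 ∧ b * p.1 < p.2}

open Classical in
/-- The function `f_Φ(x, t) = ∫_{[0, t]} μ̄(t - y) P(σ(x) ∈ dy)` on `region b`, extended by `0`. -/
def densityJump (P : Measure Ω) (σ : ℝ≥0 → Ω → ℝ≥0∞) (b : ℝ) (μ : Measure ℝ) (x t : ℝ) : ℝ≥0∞ :=
  if (x, t) ∈ region b then
    ∫⁻ y in Iic (ENNReal.ofReal t), levyTail μ (t - y.toReal) ∂(P.map (σ x.toNNReal))
  else 0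

/-- The open sector `{z ≠ 0 : |Arg z| < α}`. -/
def sector (α : ℝ) : Set ℂ := {z | z ≠ 0 ∧ |z.arg| < α}

/-- For some `θ ∈ (0, π)`, the function `Φ`, given on `Re z ≥ 0`, has an extension `F` which is
holomorphic on the sector `|Arg z| < π - θ / 2`, continuous on its closure, and such that
`F z / z → b` as `z → ∞`, uniformly in the closed sector. -/
def HasSectorialExtension (Φ : ℂ → ℂ) (b : ℝ) : Prop :=
  ∃ θ ∈ Ioo (0 : ℝ) Real.pi, ∃ F : ℂ → ℂ,
    (∀ z : ℂ, 0 ≤ z.re → F z = Φ z) ∧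
    DifferentiableOn ℂ F (sector (Real.pi - θ / 2)) ∧
    ContinuousOn F (closure (sector (Real.pi - θ / 2))) ∧
    Tendsto (fun z => F z / z)
      (Bornology.cobounded ℂ ⊓ 𝓟 (closure (sector (Real.pi - θ / 2)))) (𝓝 (b : ℂ))

end InvSubord

end

/-! Inverse Laplace transforms are computed on a contour bent into the left half-plane. The sector
contains a wedge `Re z + κ |Im z| > 0` with `0 < κ < 1`, on which `Φ` has a holomorphic extension
`F` with `F z = b z + o(|z|)`. On the contour `z = c + i r - κ |r|` the modulus of `exp (t z - x F
z)` is of order `exp (-(t - b x) κ |r| + o(|r|))`, so for `t > b x` it decays exponentially, locally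
uniformly in `(x, t)`. Hence the contour integral of `exp (t z - x F z) Q z` is smooth in `(x, t)`
for every bounded holomorphic `Q` (`contDiffOn_inverse`). The tail of `μ` has transform `(F z - q -
b z) / z`; its powers, with `x = 0`, serve the convolution powers, and its product with `exp (-x F)`
is the transform of `f_Φ` in `t`.

It remains to show that the functions equal these integrals at every point. Nothing decays on the
vertical line, so Fourier inversion is used there with a Gaussian factor, the contour is deformed
while the factor is present, and the factor is removed afterwards (`laplace_inversion`). This
requires continuity of the original function at the point, which has to be known beforehand. The
tail is monotone, so inversion holds off a countable set, and right-continuity extends it to every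
point (`measure_Ioi_toReal_eq`). The same argument for the distribution function of `σ(x)`, with
transform `exp (-x F) / z`, gives the law a continuous density beyond `b x` (`exists_density`).
Convolving the tail with such a measure yields a continuous function (`continuousAt_convMeasure`),
to which inversion applies.

The transform of the law at time `x` follows from the one at time `1` by Cauchy's functional
equation for real arguments and the identity theorem (`laplace_killedLaw_eq`). -/

noncomputable section

namespace InvSubord

/-! ### The wedge and the slanted contour -/

/-- A wedge slightly larger than the right half-plane, with sides of slope `κ`. -/
def wedge (κ : ℝ) : Set ℂ := {z | 0 < z.re + κ * |z.im|}

/-- The contour `c + i r - κ |r|`, `r ∈ ℝ`, with corner `c`. -/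
def hankelPath (κ c r : ℝ) : ℂ := c + r * Complex.I - κ * |r|

/-- The derivative of `hankelPath`, divided by `i`. -/
def hankelJac (κ r : ℝ) : ℂ := if 0 ≤ r then 1 + κ * Complex.I else 1 - κ * Complex.I

lemma mem_wedge_of_le {κ c : ℝ} (hc : 0 < c) {z : ℂ} (hz : c ≤ z.re + κ * |z.im|) : z ∈ wedge κ :=
  lt_of_lt_of_le hc hz

lemma hankelPath_re (κ c r : ℝ) : (hankelPath κ c r).re = c - κ * |r| := by
  simp [hankelPath]

lemma hankelPath_im (κ c r : ℝ) : (hankelPath κ c r).im = r := by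
  simp [hankelPath]

lemma hankelPath_level (κ c r : ℝ) :
    (hankelPath κ c r).re + κ * |(hankelPath κ c r).im| = c := by
  rw [hankelPath_re, hankelPath_im]; ring

lemma continuous_hankelPath (κ c : ℝ) : Continuous (hankelPath κ c) := by
  unfold hankelPath; fun_prop

lemma measurable_hankelJac (κ : ℝ) : Measurable (hankelJac κ) :=
  Measurable.ite measurableSet_Ici measurable_const measurable_const

lemma norm_hankelJac_le (κ r : ℝ) : ‖hankelJac κ r‖ ≤ 1 + |κ| := by
  unfold hankelJac
  split_ifs
  · refine (norm_add_le _ _).trans (by simp)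
  · refine (norm_sub_le _ _).trans (by simp)

/-- The wedge itself is not convex when `κ > 0`, but it is the union of these two half-planes, on
each of which a holomorphic function has a primitive. This is why the two halves of the vertical
line are rotated separately. -/
lemma halfPlane_subset_wedge {κ s : ℝ} (hκ : 0 ≤ κ) (hs : s = 1 ∨ s = -1) :
    {z : ℂ | 0 < z.re + κ * (s * z.im)} ⊆ wedge κ := by
  intro z hz
  have h : s * z.im ≤ |z.im| := by
    rcases hs with rfl | rfl
    · simpa using le_abs_self z.im
    · simpa using neg_le_abs z.im
  have := mul_le_mul_of_nonneg_left h hκ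
  simp only [wedge, mem_ofPred_eq] at hz ⊢
  linarith

/-! ### Contour deformation under Gaussian damping -/

lemma intervalIntegral_ray {U : Set ℂ} {f g : ℂ → ℂ} (hf : ContinuousOn f U)
    (hg : ∀ z ∈ U, HasDerivAt g (f z) z) (c w : ℂ) (hw : ∀ r : ℝ, 0 ≤ r → c + r * w ∈ U)
    {R : ℝ} (hR : 0 ≤ R) :
    ∫ r in (0 : ℝ)..R, f (c + r * w) * w = g (c + R * w) - g c := by
  have h := intervalIntegral.integral_eq_sub_of_hasDerivAt (a := 0) (b := R)
    (f := fun r : ℝ => g (c + r * w)) (f' := fun r : ℝ => f (c + r * w) * w) ?_ ?_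
  · simpa using h
  · intro r hr
    rw [uIcc_of_le hR] at hr
    have h1 : HasDerivAt (fun r : ℝ => c + (r : ℂ) * w) w r := by
      simpa using ((Complex.ofRealCLM.hasDerivAt (x := r)).mul_const w).const_add c
    exact (hg _ (hw r hr.1)).comp r h1
  · apply ContinuousOn.intervalIntegrable
    rw [uIcc_of_le hR]
    refine ContinuousOn.mul (hf.comp (by fun_prop) fun r hr => hw r hr.1) continuousOn_const

/-- Rotation of a vertical ray to a slanted one, for a function that decays in between. -/
lemma integral_ray_rotate {κ c s : ℝ} (hκ : 0 ≤ κ) (hc : 0 < c) (hs : s * s = 1) {f : ℂ → ℂ}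
    (hf : DifferentiableOn ℂ f {z | 0 < z.re + κ * (s * z.im)})
    (h1 : IntegrableOn (fun r : ℝ => f (c + r * (s * Complex.I))) (Ioi 0))
    (h2 : IntegrableOn (fun r : ℝ => f (c + r * (s * Complex.I - κ))) (Ioi 0))
    {β : ℝ → ℝ} (hβ : ∀ r > 0, ∀ u ∈ Icc 0 (κ * r), ‖f (c + r * (s * Complex.I) - u)‖ ≤ β r)
    (hlim : Tendsto (fun r => β r * r) atTop (𝓝 0)) :
    ∫ r in Ioi (0 : ℝ), f (c + r * (s * Complex.I)) * (s * Complex.I) =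
      ∫ r in Ioi (0 : ℝ), f (c + r * (s * Complex.I - κ)) * (s * Complex.I - κ) := by
  set U : Set ℂ := {z | 0 < z.re + κ * (s * z.im)}
  have hopen : IsOpen U := isOpen_lt continuous_const (by fun_prop)
  have hconv : Convex ℝ U := by
    intro x hx y hy a b ha hb hab
    simp only [U, mem_ofPred_eq, Complex.add_re, Complex.add_im, Complex.smul_re, Complex.smul_im,
      smul_eq_mul] at hx hy ⊢
    rcases ha.eq_or_lt with rfl | ha
    · have : b = 1 := by linarith
      subst this; simpa using hy
    · nlinarith [mul_pos ha hx, mul_nonneg hb hy.le]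
  -- A primitive takes the place of Cauchy's theorem: the two integrals truncated at `R` differ by
  -- the increment of `g` over the horizontal segment joining the end points, which has length `κ *
  -- R` and on which the derivative is bounded by `β R`.
  obtain ⟨g, hg'⟩ := hconv.exists_forall_hasDerivWithinAt hf
  have hg : ∀ z ∈ U, HasDerivAt g (f z) z := fun z hz =>
    (hg' z hz).hasDerivAt (hopen.mem_nhds hz)
  have hmem : ∀ r u : ℝ, 0 ≤ r → u ≤ κ * r → (c : ℂ) + r * (s * Complex.I) - u ∈ U := by
    intro r u hr hu
    simp only [U, mem_ofPred_eq, Complex.add_re, Complex.sub_re, Complex.ofReal_re, Complex.mul_re,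
      Complex.ofReal_im, Complex.I_re, Complex.I_im, Complex.add_im, Complex.sub_im, Complex.mul_im]
    have : κ * (s * (r * s)) = κ * r := by linear_combination κ * r * hs
    ring_nf at this ⊢
    linarith
  have hw1 : ∀ r : ℝ, 0 ≤ r → (c : ℂ) + r * (s * Complex.I) ∈ U := fun r hr => by
    simpa using hmem r 0 hr (by positivity)
  have e2 : ∀ r : ℝ, (c : ℂ) + r * (s * Complex.I - κ) = c + r * (s * Complex.I) - (κ * r : ℝ) := by
    intro r; push_cast; ring
  have hw2 : ∀ r : ℝ, 0 ≤ r → (c : ℂ) + r * (s * Complex.I - κ) ∈ U := fun r hr => by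
    rw [e2]; exact hmem r _ hr le_rfl
  have t1 := intervalIntegral_tendsto_integral_Ioi 0 (h1.mul_const (s * Complex.I)) tendsto_id
  have t2 := intervalIntegral_tendsto_integral_Ioi 0 (h2.mul_const (s * Complex.I - κ)) tendsto_id
  have t3 := t1.sub t2
  refine sub_eq_zero.1 (tendsto_nhds_unique t3 ?_)
  refine squeeze_zero_norm' ?_ (by simpa using hlim.const_mul κ)
  filter_upwards [eventually_gt_atTop 0] with R hR
  have hc' := hf.continuousOn
  rw [id, intervalIntegral_ray hc' hg _ _ hw1 hR.le,
    intervalIntegral_ray hc' hg _ _ hw2 hR.le, sub_sub_sub_cancel_right]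
  have hseg : ∀ z ∈ segment ℝ ((c : ℂ) + R * (s * Complex.I - κ)) (c + R * (s * Complex.I)),
      ∃ u ∈ Icc 0 (κ * R), z = c + R * (s * Complex.I) - (u : ℝ) := by
    rintro z ⟨a, b, ha, hb, hab, rfl⟩
    have hab' : (a : ℂ) + b = 1 := by exact_mod_cast hab
    refine ⟨a * (κ * R), ⟨by positivity, ?_⟩, ?_⟩
    · have : 0 ≤ κ * R := by positivity
      nlinarith
    · simp only [Complex.real_smul]
      push_cast
      linear_combination (c + R * (s * Complex.I)) * hab'
  have := (convex_segment ((c : ℂ) + R * (s * Complex.I - κ))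
    (c + R * (s * Complex.I))).norm_image_sub_le_of_norm_hasDerivWithin_le
    (f := g) (f' := f) (C := β R) (fun z hz => by
      obtain ⟨u, hu, rfl⟩ := hseg z hz
      exact (hg _ (hmem R u hR.le hu.2)).hasDerivWithinAt)
    (fun z hz => by
      obtain ⟨u, hu, rfl⟩ := hseg z hz
      exact hβ R hR u hu) (left_mem_segment _ _ _) (right_mem_segment _ _ _)
  refine this.trans (le_of_eq ?_)
  have : (c : ℂ) + R * (s * Complex.I) - (c + R * (s * Complex.I - κ)) = (κ * R : ℝ) := by
    push_cast; ring
  rw [this, Complex.norm_real, Real.norm_of_nonneg (by positivity)]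
  ring

/-- Between the two rays `|exp (δ (z - c)²)| = exp (δ (u² - r²))` with `u ≤ κ r`. Since `κ < 1`,
this is Gaussian decay in `r`, which beats the exponential growth of the other two factors. -/
lemma gaussian_damped_bound {κ c s B t δ : ℝ} (hκ : 0 ≤ κ) (hκ1 : κ < 1) (hc : 0 < c)
    (hs : s = 1 ∨ s = -1) (hB : 0 ≤ B) (hδ : 0 < δ) {A : ℝ} (hA : 0 ≤ A) {L : ℂ → ℂ}
    (hL : ∀ z : ℂ, c ≤ z.re + κ * |z.im| → ‖L z‖ ≤ A * Real.exp (B * ‖z‖)) :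
    ∃ C, ∀ r > 0, ∀ u ∈ Icc 0 (κ * r),
      ‖Complex.exp ((c + r * (s * Complex.I) - (u : ℝ)) * t) *
        Complex.exp (δ * ((c + r * (s * Complex.I) - (u : ℝ)) - c) ^ 2) *
        L (c + r * (s * Complex.I) - (u : ℝ))‖ ≤ C * Real.exp (-r) := by
  set K := |t| + B
  have hη : 0 < δ * (1 - κ ^ 2) := by
    have : κ ^ 2 < 1 := by nlinarith
    exact mul_pos hδ (by linarith)
  set η := δ * (1 - κ ^ 2)
  -- With `‖z‖ ≤ c + 2 * r`, the exponent is at most `K * c + 2 * K * r - η * r ^ 2`. Setting aside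
  -- `-r` and completing the square in `(2 * K + 1) * r - η * r ^ 2` gives this constant.
  refine ⟨A * Real.exp (K * c + (2 * K + 1) ^ 2 / (4 * η)), fun r hr u hu => ?_⟩
  set z : ℂ := c + r * (s * Complex.I) - (u : ℝ) with hz
  have hs2 : s * s = 1 := by rcases hs with rfl | rfl <;> norm_num
  have hsabs : |s| = 1 := by rcases hs with rfl | rfl <;> norm_num
  have hre : z.re = c - u := by simp [hz]
  have him : z.im = r * s := by simp [hz]
  have hu2 : u ≤ r := hu.2.trans (by nlinarith)
  have hzn : ‖z‖ ≤ c + 2 * r := by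
    refine (Complex.norm_le_abs_re_add_abs_im z).trans ?_
    rw [hre, him, abs_mul, hsabs, abs_of_pos hr]
    have : |c - u| ≤ c + u := by rw [abs_le]; constructor <;> linarith [hu.1]
    linarith
  have hLz := hL z (by
    rw [hre, him, abs_mul, hsabs, abs_of_pos hr]; linarith [hu.2])
  have e1 : ‖Complex.exp (z * t)‖ ≤ Real.exp (|t| * ‖z‖) := by
    rw [Complex.norm_exp, Real.exp_le_exp]
    refine (Complex.re_le_norm _).trans ?_
    rw [norm_mul, Complex.norm_real, Real.norm_eq_abs, mul_comm]
  have e2 : ‖Complex.exp (δ * (z - c) ^ 2)‖ ≤ Real.exp (-(η * r ^ 2)) := by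
    rw [Complex.norm_exp, Real.exp_le_exp]
    have : ((δ : ℂ) * (z - c) ^ 2).re = δ * (u ^ 2 - r ^ 2) := by
      rw [Complex.re_ofReal_mul, sq, Complex.mul_re]
      simp only [Complex.sub_re, Complex.sub_im, Complex.ofReal_re, Complex.ofReal_im, hre, him]
      linear_combination (- δ * r ^ 2) * hs2
    rw [this]
    have h3 : u ^ 2 ≤ κ ^ 2 * r ^ 2 := by
      rw [← mul_pow]; exact pow_le_pow_left₀ hu.1 hu.2 2
    simp only [η]
    nlinarith
  rw [norm_mul, norm_mul]
  calc _ ≤ Real.exp (|t| * ‖z‖) * Real.exp (-(η * r ^ 2)) * (A * Real.exp (B * ‖z‖)) := by gcongr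
    _ = A * Real.exp (K * ‖z‖ - η * r ^ 2) := by
      rw [show K * ‖z‖ - η * r ^ 2 = |t| * ‖z‖ + -(η * r ^ 2) + B * ‖z‖ by simp only [K]; ring,
        Real.exp_add, Real.exp_add]; ring
    _ ≤ A * Real.exp (K * c + (2 * K + 1) ^ 2 / (4 * η) + -r) := by
      gcongr
      have hK : 0 ≤ K := by positivity
      have h1 : K * ‖z‖ ≤ K * (c + 2 * r) := by gcongr
      have h2 : (2 * K + 1) * r - η * r ^ 2 ≤ (2 * K + 1) ^ 2 / (4 * η) := by
        rw [le_div_iff₀ (by positivity)]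
        nlinarith [sq_nonneg (2 * η * r - (2 * K + 1))]
      linarith
    _ = _ := by rw [Real.exp_add]; ring

lemma integral_eq_add_integral_neg (h : ℝ → ℂ) (i1 : IntegrableOn h (Ioi 0))
    (i2 : IntegrableOn (fun r => h (-r)) (Ioi 0)) :
    ∫ r, h r = (∫ r in Ioi 0, h r) + ∫ r in Ioi 0, h (-r) := by
  have i2' : IntegrableOn h (Iic 0) := by
    rw [integrableOn_Iic_iff_integrableOn_Iio]
    have i3 : IntegrableOn (fun r => h (-r)) (Ioi (-0)) := by rwa [neg_zero]
    simpa using i3.comp_neg_Iio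
  rw [← intervalIntegral.integral_Iic_add_Ioi i2' i1, integral_comp_neg_Ioi, neg_zero, add_comm]

/-- Deformation of the vertical line to the contour `hankelPath`, with a Gaussian factor. -/
lemma integral_vertical_eq_hankel {κ c B t δ : ℝ} (hκ : 0 ≤ κ) (hκ1 : κ < 1) (hc : 0 < c)
    (hB : 0 ≤ B) (hδ : 0 < δ) {A : ℝ} (hA : 0 ≤ A) {L : ℂ → ℂ}
    (hdiff : DifferentiableOn ℂ L (wedge κ))
    (hL : ∀ z : ℂ, c ≤ z.re + κ * |z.im| → ‖L z‖ ≤ A * Real.exp (B * ‖z‖)) :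
    ∫ r : ℝ, Complex.exp ((c + r * Complex.I) * t) *
        Complex.exp (δ * ((c + r * Complex.I) - c) ^ 2) * L (c + r * Complex.I) =
      ∫ r : ℝ, Complex.exp (hankelPath κ c r * t) *
        Complex.exp (δ * (hankelPath κ c r - c) ^ 2) * L (hankelPath κ c r) * hankelJac κ r := by
  set f : ℂ → ℂ := fun z => Complex.exp (z * t) * Complex.exp (δ * (z - c) ^ 2) * L z with hf
  have hfd : DifferentiableOn ℂ f (wedge κ) := by
    refine DifferentiableOn.mul (Differentiable.differentiableOn (by fun_prop)) hdiff
  have key : ∀ s : ℝ, (s = 1 ∨ s = -1) →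
      IntegrableOn (fun r : ℝ => f (c + r * (s * Complex.I))) (Ioi 0) ∧
      IntegrableOn (fun r : ℝ => f (c + r * (s * Complex.I - κ))) (Ioi 0) ∧
      ∫ r in Ioi (0 : ℝ), f (c + r * (s * Complex.I)) =
      ∫ r in Ioi (0 : ℝ), f (c + r * (s * Complex.I - κ)) * (1 + s * κ * Complex.I) := by
    intro s hs
    have hs2 : s * s = 1 := by rcases hs with rfl | rfl <;> norm_num
    have hsabs : |s| = 1 := by rcases hs with rfl | rfl <;> norm_num
    obtain ⟨C, hC⟩ := gaussian_damped_bound (t := t) hκ hκ1 hc hs hB hδ hA hL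
    have hint : ∀ a ∈ Icc 0 κ,
        IntegrableOn (fun r : ℝ => f (c + r * (s * Complex.I - (a : ℝ)))) (Ioi 0) := by
      intro a ha
      refine Integrable.mono' (g := fun r => C * Real.exp (-r))
        ((integrableOn_exp_neg_Ioi 0).const_mul C) ?_ ?_
      · refine ContinuousOn.aestronglyMeasurable ?_ measurableSet_Ioi
        refine hfd.continuousOn.comp (by fun_prop) fun r hr => ?_
        have hr : 0 < r := hr
        simp only [wedge, mem_ofPred_eq, Complex.add_re, Complex.mul_re, Complex.sub_re,
          Complex.ofReal_re, Complex.ofReal_im, Complex.I_re, Complex.I_im, Complex.add_im,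
          Complex.mul_im, Complex.sub_im]
        have : |0 + (r * (s * 1 + 0 * 0 - 0) + 0 * (s * 0 - 0 * 1 - a))| = r := by
          ring_nf; rw [abs_mul, hsabs, abs_of_pos hr, mul_one]
        rw [this]
        nlinarith [mul_le_mul_of_nonneg_right ha.2 hr.le]
      · refine (ae_restrict_iff' measurableSet_Ioi).2 (Eventually.of_forall fun r hr => ?_)
        have := hC r hr (a * r) ⟨mul_nonneg ha.1 (le_of_lt hr),
          mul_le_mul_of_nonneg_right ha.2 (le_of_lt hr)⟩
        rw [show (c : ℂ) + r * (s * Complex.I - (a : ℝ)) =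
          c + r * (s * Complex.I) - (a * r : ℝ) by push_cast; ring]
        exact this
    have i1 : IntegrableOn (fun r : ℝ => f (c + r * (s * Complex.I))) (Ioi 0) := by
      simpa using hint 0 ⟨le_rfl, hκ⟩
    have i2 := hint κ ⟨hκ, le_rfl⟩
    refine ⟨i1, i2, ?_⟩
    have h := integral_ray_rotate hκ hc hs2 (hfd.mono (halfPlane_subset_wedge hκ hs)) i1 i2 hC (by
      have := (Real.tendsto_pow_mul_exp_neg_atTop_nhds_zero 1).const_mul C
      simpa [mul_assoc, mul_comm, mul_left_comm] using this)
    have hs2' : (s : ℂ) * s = 1 := by exact_mod_cast hs2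
    have hI := Complex.I_mul_I
    rw [integral_mul_const, integral_mul_const] at h
    rw [integral_mul_const]
    clear i1 i2 hint hC
    generalize ∫ (r : ℝ) in Ioi 0, f (↑c + ↑r * (↑s * Complex.I)) = X at h ⊢
    generalize ∫ (r : ℝ) in Ioi 0, f (↑c + ↑r * (↑s * Complex.I - κ)) = Y at h ⊢
    -- The two directions are related by `s I - κ = s I (1 + s κ I)`; the common factor `s I`
    -- cancels because its square is `-1`.
    linear_combination (-(s * Complex.I)) * h + X * (s * s * hI - hs2') -
      Y * (s * s * hI - hs2')
  obtain ⟨a1, a2, a3⟩ := key 1 (Or.inl rfl)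
  obtain ⟨b1, b2, b3⟩ := key (-1) (Or.inr rfl)
  have pth1 : ∀ r : ℝ, 0 < r → hankelPath κ c r = c + r * ((1 : ℝ) * Complex.I - κ) := by
    intro r hr; simp only [hankelPath, abs_of_pos hr]; push_cast; ring
  have pth2 : ∀ r : ℝ, 0 < r → hankelPath κ c (-r) = c + r * ((-1 : ℝ) * Complex.I - κ) := by
    intro r hr; simp only [hankelPath, abs_neg, abs_of_pos hr]; push_cast; ring
  have q1 : ∀ r ∈ Ioi (0 : ℝ), f (hankelPath κ c r) * hankelJac κ r =
      f (c + r * ((1 : ℝ) * Complex.I - κ)) * (1 + (1 : ℝ) * κ * Complex.I) := by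
    intro r hr; rw [pth1 r hr, hankelJac, if_pos (le_of_lt hr)]; push_cast; ring
  have q2 : ∀ r ∈ Ioi (0 : ℝ), f (hankelPath κ c (-r)) * hankelJac κ (-r) =
      f (c + r * ((-1 : ℝ) * Complex.I - κ)) * (1 + (-1 : ℝ) * κ * Complex.I) := by
    intro r hr
    have hr' : (0 : ℝ) < r := hr
    rw [pth2 r hr, hankelJac, if_neg (by linarith)]; push_cast; ring
  have p1 : ∀ r : ℝ, f (c + r * Complex.I) = f (c + r * ((1 : ℝ) * Complex.I)) := by
    intro r; push_cast; ring_nf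
  have p2 : ∀ r : ℝ, f (c + (-r : ℝ) * Complex.I) = f (c + r * ((-1 : ℝ) * Complex.I)) := by
    intro r; push_cast; ring_nf
  change ∫ r : ℝ, f (c + r * Complex.I) = ∫ r : ℝ, f (hankelPath κ c r) * hankelJac κ r
  rw [integral_eq_add_integral_neg (fun r => f (c + r * Complex.I)) (by simpa only [p1] using a1)
      (by simpa only [p2] using b1),
    integral_eq_add_integral_neg (fun r => f (hankelPath κ c r) * hankelJac κ r)
      ((integrableOn_congr_fun q1 measurableSet_Ioi).2 (a2.mul_const _))
      ((integrableOn_congr_fun q2 measurableSet_Ioi).2 (b2.mul_const _)),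
    setIntegral_congr_fun measurableSet_Ioi q1, setIntegral_congr_fun measurableSet_Ioi q2]
  simp only [p2]
  simp only [p1]
  rw [a3, b3]

/-! ### Laplace inversion on the slanted contour -/

open scoped FourierTransform in
/-- Gaussian summability of the inverse Fourier integral at a point of continuity. -/
lemma tendsto_gaussian_fourier_inversion {φ : ℝ → ℂ} (hφ : Integrable φ) {t : ℝ}
    (ht : ContinuousAt φ t) :
    Tendsto (fun a : ℝ => ∫ w : ℝ, Complex.exp (-a⁻¹ * ((w ^ 2 : ℝ) : ℂ) +
      2 * Real.pi * Complex.I * (t * w : ℝ)) * 𝓕 φ w) atTop (𝓝 (φ t)) := by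
  refine (Real.tendsto_integral_gaussian_smul' hφ ht).congr' ?_
  filter_upwards [Ioi_mem_atTop 0] with c (hc : 0 < c)
  have J : Integrable (fun w : ℝ ↦ Complex.exp (- c⁻¹ * ‖w‖ ^ 2 +
      2 * Real.pi * Complex.I * inner ℝ t w)) :=
    GaussianFourier.integrable_cexp_neg_mul_sq_norm_add (by simpa) _ _
  -- Self-adjointness moves the Fourier transform from the Gaussian, where it gives an approximate
  -- identity, to `φ`.
  have h := (VectorFourier.integral_fourierIntegral_smul_eq_flip (L := innerₗ ℝ)
      Real.continuous_fourierChar continuous_inner J hφ)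
  have h' : ∫ w : ℝ, 𝓕 (fun w : ℝ => Complex.exp (- c⁻¹ * ‖w‖ ^ 2 +
      2 * Real.pi * Complex.I * inner ℝ t w)) w • φ w =
      ∫ w : ℝ, Complex.exp (- c⁻¹ * ‖w‖ ^ 2 + 2 * Real.pi * Complex.I * inner ℝ t w) • 𝓕 φ w := by
    simpa using! h
  have h2 : ∫ w : ℝ, Complex.exp (- c⁻¹ * ‖w‖ ^ 2 + 2 * Real.pi * Complex.I * inner ℝ t w) •
      𝓕 φ w = ∫ w : ℝ, Complex.exp (-c⁻¹ * ((w ^ 2 : ℝ) : ℂ) +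
      2 * Real.pi * Complex.I * (t * w : ℝ)) * 𝓕 φ w := by
    congr with w
    have : (inner ℝ t w : ℝ) = t * w := by simp [mul_comm]
    rw [this, smul_eq_mul, ← Complex.ofReal_pow, Real.norm_eq_abs, sq_abs]
  rw [← h2, ← h']
  congr with w
  rw [fourier_gaussian_innerProductSpace' (by simpa)]
  have hc' : (c : ℂ) ≠ 0 := by exact_mod_cast hc.ne'
  congr 3
  · push_cast
    field_simp
  · push_cast
    field_simp

/-- Inversion of a Laplace transform that extends holomorphically to a wedge: no decay is needed
on the vertical line, only absolute convergence on the slanted contour. -/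
theorem laplace_inversion {κ c B t A : ℝ} (hκ : 0 ≤ κ) (hκ1 : κ < 1) (hc : 0 < c)
    (hB : 0 ≤ B) (hA : 0 ≤ A) {L : ℂ → ℂ}
    (hdiff : DifferentiableOn ℂ L (wedge κ))
    (hL : ∀ z : ℂ, c ≤ z.re + κ * |z.im| → ‖L z‖ ≤ A * Real.exp (B * ‖z‖))
    (hint : Integrable fun r => Complex.exp (hankelPath κ c r * t) * L (hankelPath κ c r))
    {g : ℝ → ℂ} (hg : Integrable fun y : ℝ => Complex.exp (-(c * y)) * g y)
    (htr : ∀ r : ℝ, ∫ y : ℝ, Complex.exp (-((c + r * Complex.I) * y)) * g y =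
      L (c + r * Complex.I)) (hcont : ContinuousAt g t) :
    g t = (2 * Real.pi : ℝ)⁻¹ * ∫ r : ℝ, Complex.exp (hankelPath κ c r * t) *
      L (hankelPath κ c r) * hankelJac κ r := by
  set φ : ℝ → ℂ := fun y => Complex.exp (-(c * y)) * g y with hφ
  have hφt : ContinuousAt φ t := ContinuousAt.mul (by fun_prop) hcont
  have hF : ∀ w : ℝ, FourierTransform.fourier φ w = L (c + (2 * Real.pi * w : ℝ) * Complex.I) := by
    intro w
    rw [← htr, Real.fourier_real_eq_integral_exp_smul]
    congr with y
    rw [smul_eq_mul, hφ]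
    simp only
    rw [← mul_assoc, ← Complex.exp_add]
    congr 2
    push_cast; ring
  have h1 := tendsto_gaussian_fourier_inversion hg hφt
  set K : ℝ → ℂ := fun δ => ∫ r : ℝ, Complex.exp (hankelPath κ c r * t) *
        Complex.exp (δ * (hankelPath κ c r - c) ^ 2) * L (hankelPath κ c r) * hankelJac κ r with hK
  have hpi := Real.pi_pos
  -- The substitution `r = 2 π w` turns `-w² / a` into `δ (z - c)² = -δ r²` with `δ = a⁻¹ / (2 π)²`;
  -- only then is the contour deformed.
  have h2 : ∀ a : ℝ, 0 < a → ∫ w : ℝ, Complex.exp (-a⁻¹ * ((w ^ 2 : ℝ) : ℂ) +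
      2 * Real.pi * Complex.I * (t * w : ℝ)) * FourierTransform.fourier φ w =
      (2 * Real.pi : ℝ)⁻¹ * Complex.exp (-(c * t)) * K (a⁻¹ / (2 * Real.pi) ^ 2) := by
    intro a ha
    have hδ : 0 < a⁻¹ / (2 * Real.pi) ^ 2 := by positivity
    rw [hK]
    simp only
    rw [← integral_vertical_eq_hankel hκ hκ1 hc hB hδ hA hdiff hL, mul_assoc (((2 * Real.pi : ℝ)⁻¹ : ℝ) : ℂ),
      ← integral_const_mul]
    have := Measure.integral_comp_mul_left (fun r : ℝ => Complex.exp (-(c * t)) *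
      (Complex.exp ((c + r * Complex.I) * t) *
        Complex.exp ((a⁻¹ / (2 * Real.pi) ^ 2 : ℝ) * ((c + r * Complex.I) - c) ^ 2) *
        L (c + r * Complex.I))) (2 * Real.pi)
    rw [abs_of_pos (by positivity), Complex.real_smul] at this
    rw [← this]
    congr with w
    rw [hF, ← mul_assoc, ← mul_assoc, ← Complex.exp_add, ← Complex.exp_add]
    congr 2
    have hpi' : (Real.pi : ℂ) ≠ 0 := by exact_mod_cast hpi.ne'
    have ha' : (a : ℂ) ≠ 0 := by exact_mod_cast ha.ne'
    push_cast
    rw [add_sub_cancel_left, mul_pow _ Complex.I, Complex.I_sq]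
    field_simp
    ring
  have h3 : Tendsto (fun a : ℝ => (2 * Real.pi : ℝ)⁻¹ * Complex.exp (-(c * t)) *
      K (a⁻¹ / (2 * Real.pi) ^ 2)) atTop (𝓝 (φ t)) := by
    refine h1.congr' ?_
    filter_upwards [Ioi_mem_atTop 0] with a ha using h2 a ha
  -- On the slanted contour `Re (z - c)² = -(1 - κ²) r² ≤ 0`, so the Gaussian factor has modulus at
  -- most `1` and `hint` supplies the dominating function as `δ → 0`.
  have h4 : Tendsto (fun a : ℝ => K (a⁻¹ / (2 * Real.pi) ^ 2)) atTop
      (𝓝 (∫ r : ℝ, Complex.exp (hankelPath κ c r * t) * L (hankelPath κ c r) * hankelJac κ r)) := by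
    have hLm : Continuous fun r => L (hankelPath κ c r) :=
      hdiff.continuousOn.comp_continuous (continuous_hankelPath κ c) fun r =>
        mem_wedge_of_le hc (hankelPath_level κ c r).ge
    have hpm := continuous_hankelPath κ c
    refine tendsto_integral_filter_of_dominated_convergence
      (fun r => ‖Complex.exp (hankelPath κ c r * t) * L (hankelPath κ c r)‖ * (1 + |κ|)) ?_ ?_
      (hint.norm.mul_const _) ?_
    · refine Eventually.of_forall fun a => ?_
      exact (Continuous.mul (by fun_prop) hLm).aestronglyMeasurable.mul
        (measurable_hankelJac κ).aestronglyMeasurable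
    · filter_upwards [Ioi_mem_atTop 0] with a ha
      have ha : 0 < a := ha
      refine Eventually.of_forall fun r => ?_
      rw [norm_mul]
      refine mul_le_mul ?_ (norm_hankelJac_le κ r) (norm_nonneg _) (norm_nonneg _)
      rw [mul_right_comm, norm_mul]
      refine mul_le_of_le_one_right (norm_nonneg _) ?_
      rw [Complex.norm_exp, Real.exp_le_one_iff, Complex.re_ofReal_mul]
      refine mul_nonpos_of_nonneg_of_nonpos (by positivity) ?_
      rw [sq, Complex.mul_re, Complex.sub_re, Complex.sub_im, hankelPath_re, hankelPath_im]
      simp only [Complex.ofReal_re, Complex.ofReal_im]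
      have h7 : (c - κ * |r| - c) * (c - κ * |r| - c) - (r - 0) * (r - 0) =
          -((1 - κ) * (1 + κ) * (r * r)) := by
        linear_combination κ ^ 2 * abs_mul_abs_self r
      rw [h7, neg_nonpos]
      exact mul_nonneg (mul_nonneg (by linarith) (by linarith)) (mul_self_nonneg r)
    · refine Eventually.of_forall fun r => ?_
      have hz : Tendsto (fun a : ℝ => ((a⁻¹ / (2 * Real.pi) ^ 2 : ℝ) : ℂ)) atTop (𝓝 0) := by
        have := tendsto_inv_atTop_zero (𝕜 := ℝ)
        have := (this.div_const ((2 * Real.pi) ^ 2)).ofReal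
        simpa using this
      have h5 := ((hz.mul_const ((hankelPath κ c r - c) ^ 2)).cexp)
      rw [zero_mul, Complex.exp_zero] at h5
      have h6 := ((h5.const_mul (Complex.exp (hankelPath κ c r * t))).mul_const
        (L (hankelPath κ c r))).mul_const (hankelJac κ r)
      simpa using h6
  have h5 := tendsto_nhds_unique h3 (h4.const_mul ((2 * Real.pi : ℝ)⁻¹ * Complex.exp (-(c * t))))
  have h6 : Complex.exp (c * t) * Complex.exp (-(c * t)) = 1 := by
    rw [← Complex.exp_add, add_neg_cancel, Complex.exp_zero]
  rw [hφ] at h5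
  simp only at h5
  calc g t = Complex.exp (c * t) * (Complex.exp (-(c * t)) * g t) := by
        rw [← mul_assoc, h6, one_mul]
    _ = _ := by
      rw [h5]
      rw [show ∀ x y z w : ℂ, x * (y * z * w) = (x * z) * (y * w) by intros; ring, h6, one_mul]

/-! ### Smoothness of exponential integrals in the parameters -/

/-- Measurable functions on the line of at most polynomial growth. -/
def PolyGrowth (q : ℝ → ℂ) : Prop :=
  Measurable q ∧ ∃ C : ℝ, ∃ m : ℕ, ∀ r, ‖q r‖ ≤ C * (1 + |r|) ^ m

lemma PolyGrowth.mul {p q : ℝ → ℂ} (hp : PolyGrowth p) (hq : PolyGrowth q) :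
    PolyGrowth fun r => p r * q r := by
  obtain ⟨hpm, C, m, hC⟩ := hp
  obtain ⟨hqm, D, n, hD⟩ := hq
  refine ⟨hpm.mul hqm, C * D, m + n, fun r => ?_⟩
  rw [norm_mul, pow_add]
  calc _ ≤ (C * (1 + |r|) ^ m) * (D * (1 + |r|) ^ n) :=
        mul_le_mul (hC r) (hD r) (norm_nonneg _) ((norm_nonneg _).trans (hC r))
    _ = _ := by ring

lemma PolyGrowth.neg {p : ℝ → ℂ} (hp : PolyGrowth p) : PolyGrowth fun r => -p r := by
  obtain ⟨hpm, C, m, hC⟩ := hp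
  exact ⟨hpm.neg, C, m, fun r => by simpa using hC r⟩

lemma integrable_exp_neg_mul_abs {a : ℝ} (ha : 0 < a) :
    Integrable fun r : ℝ => Real.exp (-(a * |r|)) := by
  have h1 : IntegrableOn (fun r : ℝ => Real.exp (-(a * |r|))) (Ioi 0) := by
    refine (integrableOn_congr_fun (fun r (hr : 0 < r) => ?_) measurableSet_Ioi).2
      (exp_neg_integrableOn_Ioi 0 ha)
    simp [abs_of_pos hr]
  have h2 : IntegrableOn (fun r : ℝ => Real.exp (-(a * |r|))) (Iic 0) := by
    rw [integrableOn_Iic_iff_integrableOn_Iio]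
    have i3 : IntegrableOn (fun r : ℝ => Real.exp (-(a * |r|))) (Ioi (-0)) := by rwa [neg_zero]
    simpa using i3.comp_neg_Iio
  have := h2.union h1
  rwa [Iic_union_Ioi, integrableOn_univ] at this

lemma integrable_pow_mul_exp_neg_abs {a : ℝ} (ha : 0 < a) (m : ℕ) :
    Integrable fun r : ℝ => (1 + |r|) ^ m * Real.exp (-(a * |r|)) := by
  refine ((integrable_exp_neg_mul_abs (half_pos ha)).const_mul
    ((m.factorial : ℝ) * (2 / a) ^ m * Real.exp (a / 2))).mono'
    (Continuous.aestronglyMeasurable (by fun_prop)) (Eventually.of_forall fun r => ?_)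
  have h := Real.pow_div_factorial_le_exp (x := a / 2 * (1 + |r|)) (by positivity) m
  rw [div_le_iff₀ (by positivity), mul_pow] at h
  have h2 : (1 + |r|) ^ m ≤ (m.factorial : ℝ) * (2 / a) ^ m * Real.exp (a / 2 * (1 + |r|)) := by
    have h3 : (2 / a) ^ m * (a / 2) ^ m = 1 := by
      rw [← mul_pow]; field_simp; simp
    calc (1 + |r|) ^ m = (2 / a) ^ m * ((a / 2) ^ m * (1 + |r|) ^ m) := by
          rw [← mul_assoc, h3, one_mul]
      _ ≤ (2 / a) ^ m * (Real.exp (a / 2 * (1 + |r|)) * m.factorial) := by gcongr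
      _ = _ := by ring
  rw [Real.norm_of_nonneg (by positivity)]
  calc _ ≤ (m.factorial : ℝ) * (2 / a) ^ m * Real.exp (a / 2 * (1 + |r|)) *
        Real.exp (-(a * |r|)) := by gcongr
    _ = _ := by
      rw [mul_assoc, mul_assoc _ (Real.exp _), ← Real.exp_add, ← Real.exp_add]
      ring_nf

/-- The integral `∫ exp (t Z(r) - x W(r)) q(r) dr` at the point `(x, t)`. -/
def expIntegral (Z W q : ℝ → ℂ) (p : ℝ × ℝ) : ℂ :=
  ∫ r : ℝ, Complex.exp (p.2 * Z r - p.1 * W r) * q r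

/-- Locally uniform exponential decay of `exp (t Z(r) - x W(r))` on `U`. -/
def ExpDecay (Z W : ℝ → ℂ) (U : Set (ℝ × ℝ)) : Prop :=
  ∀ p ∈ U, ∃ s ∈ 𝓝 p, ∃ K a : ℝ, 0 < a ∧
    ∀ x ∈ s, ∀ r : ℝ, ‖Complex.exp (x.2 * Z r - x.1 * W r)‖ ≤ K * Real.exp (-(a * |r|))

lemma integrable_expIntegral {Z W q : ℝ → ℂ} {U : Set (ℝ × ℝ)} (hZ : PolyGrowth Z)
    (hW : PolyGrowth W) (hU : ExpDecay Z W U) (hq : PolyGrowth q) {p : ℝ × ℝ} (hp : p ∈ U) :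
    Integrable fun r : ℝ => Complex.exp (p.2 * Z r - p.1 * W r) * q r := by
  obtain ⟨s, hs, K, a, ha, hb⟩ := hU p hp
  obtain ⟨hqm, C, m, hC⟩ := hq
  have hZm := hZ.1
  have hWm := hW.1
  refine ((integrable_pow_mul_exp_neg_abs ha m).const_mul (K * C)).mono'
    (Measurable.aestronglyMeasurable (by fun_prop)) (Eventually.of_forall fun r => ?_)
  have h1 := hb p (mem_of_mem_nhds hs) r
  rw [norm_mul]
  calc _ ≤ (K * Real.exp (-(a * |r|))) * (C * (1 + |r|) ^ m) :=
        mul_le_mul h1 (hC r) (norm_nonneg _) ((norm_nonneg _).trans h1)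
    _ = _ := by ring

/-- Differentiation multiplies the amplitude `q` by `Z` or `-W`, which keeps polynomial growth. The
derivative is thus a fixed continuous linear image of two integrals of the same kind, and induction
over all amplitudes at once gives every order of smoothness. -/
lemma hasFDerivAt_expIntegral {Z W q : ℝ → ℂ} {U : Set (ℝ × ℝ)} (hZ : PolyGrowth Z)
    (hW : PolyGrowth W) (hU : ExpDecay Z W U) (hq : PolyGrowth q) {p : ℝ × ℝ} (hp : p ∈ U) :
    HasFDerivAt (expIntegral Z W q)
      (ContinuousLinearMap.smulRightL ℝ (ℝ × ℝ) ℂ (ContinuousLinearMap.snd ℝ ℝ ℝ)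
        (expIntegral Z W (fun r => Z r * q r) p) +
      ContinuousLinearMap.smulRightL ℝ (ℝ × ℝ) ℂ (ContinuousLinearMap.fst ℝ ℝ ℝ)
        (expIntegral Z W (fun r => -W r * q r) p)) p := by
  have hZm := hZ.1
  have hWm := hW.1
  have hqm := hq.1
  have iZ := integrable_expIntegral hZ hW hU (hZ.mul hq) hp
  have iW := integrable_expIntegral hZ hW hU (hW.neg.mul hq) hp
  set S := ContinuousLinearMap.smulRightL ℝ (ℝ × ℝ) ℂ (ContinuousLinearMap.snd ℝ ℝ ℝ)
  set T := ContinuousLinearMap.smulRightL ℝ (ℝ × ℝ) ℂ (ContinuousLinearMap.fst ℝ ℝ ℝ)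
  rw [expIntegral, expIntegral, ← S.integral_comp_comm iZ, ← T.integral_comp_comm iW,
    ← integral_add (S.integrable_comp iZ) (T.integrable_comp iW)]
  obtain ⟨s, hs, K, a, ha, hb⟩ := hU p hp
  obtain ⟨-, C, m, hC⟩ := hZ.mul hq
  obtain ⟨-, D, n, hD⟩ := hW.neg.mul hq
  refine hasFDerivAt_integral_of_dominated_of_fderiv_le (s := s)
    (F := fun (x : ℝ × ℝ) r => Complex.exp (x.2 * Z r - x.1 * W r) * q r)
    (F' := fun (x : ℝ × ℝ) r => S (Complex.exp (x.2 * Z r - x.1 * W r) * (Z r * q r)) +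
      T (Complex.exp (x.2 * Z r - x.1 * W r) * (-W r * q r)))
    (bound := fun r => ‖S‖ * (K * C * ((1 + |r|) ^ m * Real.exp (-(a * |r|)))) +
      ‖T‖ * (K * D * ((1 + |r|) ^ n * Real.exp (-(a * |r|)))))
    hs (Eventually.of_forall fun x => Measurable.aestronglyMeasurable (by fun_prop))
    (integrable_expIntegral hZ hW hU hq hp)
    ((S.integrable_comp iZ).add (T.integrable_comp iW)).aestronglyMeasurable
    (Eventually.of_forall fun r x hx => ?_)
    ((((integrable_pow_mul_exp_neg_abs ha m).const_mul _).const_mul _).add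
      (((integrable_pow_mul_exp_neg_abs ha n).const_mul _).const_mul _))
    (Eventually.of_forall fun r x _ => ?_)
  · have h1 := hb x hx r
    refine (norm_add_le _ _).trans (add_le_add ?_ ?_)
    · refine (S.le_opNorm _).trans (mul_le_mul_of_nonneg_left ?_ (norm_nonneg _))
      rw [norm_mul]
      calc _ ≤ (K * Real.exp (-(a * |r|))) * (C * (1 + |r|) ^ m) :=
            mul_le_mul h1 (hC r) (norm_nonneg _) ((norm_nonneg _).trans h1)
        _ = _ := by ring
    · refine (T.le_opNorm _).trans (mul_le_mul_of_nonneg_left ?_ (norm_nonneg _))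
      rw [norm_mul]
      calc _ ≤ (K * Real.exp (-(a * |r|))) * (D * (1 + |r|) ^ n) :=
            mul_le_mul h1 (hD r) (norm_nonneg _) ((norm_nonneg _).trans h1)
        _ = _ := by ring
  · have d2 : HasFDerivAt (fun x : ℝ × ℝ => (x.2 : ℂ))
        (Complex.ofRealCLM.comp (ContinuousLinearMap.snd ℝ ℝ ℝ)) x :=
      (Complex.ofRealCLM.comp (ContinuousLinearMap.snd ℝ ℝ ℝ)).hasFDerivAt
    have d1 : HasFDerivAt (fun x : ℝ × ℝ => (x.1 : ℂ))
        (Complex.ofRealCLM.comp (ContinuousLinearMap.fst ℝ ℝ ℝ)) x :=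
      (Complex.ofRealCLM.comp (ContinuousLinearMap.fst ℝ ℝ ℝ)).hasFDerivAt
    have d3 := (((d2.mul_const (Z r)).sub (d1.mul_const (W r))).cexp).mul_const (q r)
    refine d3.congr_fderiv ?_
    ext
    · simp [S, T]; ring
    · simp [S, T]; ring

lemma contDiffOn_expIntegral {Z W q : ℝ → ℂ} {U : Set (ℝ × ℝ)} (hUo : IsOpen U)
    (hZ : PolyGrowth Z) (hW : PolyGrowth W) (hU : ExpDecay Z W U) (hq : PolyGrowth q) :
    ContDiffOn ℝ (⊤ : ℕ∞) (expIntegral Z W q) U := by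
  refine contDiffOn_infty.2 fun n => ?_
  induction n generalizing q with
  | zero =>
    exact contDiffOn_zero.2 fun p hp =>
      (hasFDerivAt_expIntegral hZ hW hU hq hp).continuousAt.continuousWithinAt
  | succ n ih =>
    push_cast
    refine (contDiffOn_succ_iff_fderiv_of_isOpen hUo).2 ⟨fun p hp =>
      (hasFDerivAt_expIntegral hZ hW hU hq hp).differentiableAt.differentiableWithinAt,
      by simp, ?_⟩
    refine ContDiffOn.congr ?_ fun p hp => (hasFDerivAt_expIntegral hZ hW hU hq hp).fderiv
    exact ((ContinuousLinearMap.contDiff _).comp_contDiffOn (ih (hZ.mul hq))).add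
      ((ContinuousLinearMap.contDiff _).comp_contDiffOn (ih (hW.neg.mul hq)))

/-! ### The extended exponent on the wedge and the inverse transform -/

/-- `F` is holomorphic on the wedge and asymptotic to `b z` there. -/
structure IsWedgeExtension (κ b : ℝ) (F : ℂ → ℂ) : Prop where
  pos : 0 < κ
  lt_one : κ < 1
  diff : DifferentiableOn ℂ F (wedge κ)
  lin : Tendsto (fun z => F z / z) (Bornology.cobounded ℂ ⊓ 𝓟 (wedge κ)) (𝓝 (b : ℂ))

/-- Outside the sector `Re z ≤ -cos (θ / 2) |z|`, whereas in the wedge `Re z > -κ |z|`. Half the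
cosine is a safe slope: it is positive, at most `1 / 2`, and smaller than the cosine. -/
lemma wedge_subset_sector {θ : ℝ} (hθ : θ ∈ Ioo 0 Real.pi) :
    wedge (Real.cos (θ / 2) / 2) ⊆ sector (Real.pi - θ / 2) := by
  intro z hz
  have hcos : 0 < Real.cos (θ / 2) :=
    Real.cos_pos_of_mem_Ioo ⟨by linarith [hθ.1, Real.pi_pos], by linarith [hθ.2]⟩
  simp only [wedge, mem_ofPred_eq] at hz
  have hz0 : z ≠ 0 := by rintro rfl; simp at hz
  refine ⟨hz0, ?_⟩
  by_contra! h
  have h1 : Real.cos |z.arg| ≤ Real.cos (Real.pi - θ / 2) :=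
    Real.cos_le_cos_of_nonneg_of_le_pi (by linarith [hθ.2, Real.pi_pos]) (Complex.abs_arg_le_pi z) h
  have hn : 0 < ‖z‖ := norm_pos_iff.2 hz0
  rw [Real.cos_abs, Complex.cos_arg hz0, Real.cos_pi_sub, div_le_iff₀ hn] at h1
  have h2 : |z.im| ≤ ‖z‖ := Complex.abs_im_le_norm z
  nlinarith [mul_pos hcos hn]

lemma HasSectorialExtension.exists_wedge {Φ : ℂ → ℂ} {b : ℝ} (h : HasSectorialExtension Φ b) :
    ∃ κ F, IsWedgeExtension κ b F ∧ ∀ z : ℂ, 0 ≤ z.re → F z = Φ z := by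
  obtain ⟨θ, hθ, F, hF, hd, -, hl⟩ := h
  have hcos : 0 < Real.cos (θ / 2) :=
    Real.cos_pos_of_mem_Ioo ⟨by linarith [hθ.1, Real.pi_pos], by linarith [hθ.2]⟩
  have hsub := wedge_subset_sector hθ
  refine ⟨Real.cos (θ / 2) / 2, F, ⟨by positivity, by linarith [Real.cos_le_one (θ / 2)],
    hd.mono hsub, hl.mono_left ?_⟩, hF⟩
  exact inf_le_inf_left _ (principal_mono.2 (hsub.trans subset_closure))

namespace IsWedgeExtension

variable {κ b c : ℝ} {F : ℂ → ℂ}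

lemma half_le_norm (hF : IsWedgeExtension κ b F) {z : ℂ}
    (hz : c ≤ z.re + κ * |z.im|) : c / 2 ≤ ‖z‖ := by
  have h1 := Complex.re_le_norm z
  have h2 := Complex.abs_im_le_norm z
  have h3 : κ * |z.im| ≤ 1 * ‖z‖ :=
    mul_le_mul hF.lt_one.le h2 (abs_nonneg _) zero_le_one
  linarith

/-- The limit of `F z / z` gives the bound outside a ball; inside, the closed region is compact and
stays in the open wedge. That `ε` is arbitrary matters in `expDecay`. -/
lemma lin_bound (hF : IsWedgeExtension κ b F) (hc : 0 < c) {ε : ℝ} (hε : 0 < ε) :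
    ∃ C, 0 ≤ C ∧ ∀ z : ℂ, c ≤ z.re + κ * |z.im| → ‖F z - b * z‖ ≤ C + ε * ‖z‖ := by
  have h1 : ∀ᶠ z in Bornology.cobounded ℂ, z ∈ wedge κ → ‖F z / z - b‖ < ε := by
    have := (Metric.tendsto_nhds.1 hF.lin) ε hε
    rw [eventually_inf_principal] at this
    simpa [dist_eq_norm] using this
  obtain ⟨R, -, hR⟩ := (hasBasis_cobounded_norm (E := ℂ)).eventually_iff.1 h1
  have hK : IsCompact (Metric.closedBall (0 : ℂ) R ∩ {z | c ≤ z.re + κ * |z.im|}) :=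
    (isCompact_closedBall _ _).inter_right (isClosed_le continuous_const (by fun_prop))
  have hcont : ContinuousOn (fun z => F z - b * z)
      (Metric.closedBall (0 : ℂ) R ∩ {z | c ≤ z.re + κ * |z.im|}) :=
    (hF.diff.continuousOn.mono fun z hz => mem_wedge_of_le hc hz.2).sub (by fun_prop)
  obtain ⟨C, hC⟩ := hK.exists_bound_of_continuousOn hcont
  refine ⟨max C 0, le_max_right _ _, fun z hz => ?_⟩
  by_cases hzR : ‖z‖ ≤ R
  · have := hC z ⟨by simpa using hzR, hz⟩
    have h3 := le_max_left C 0
    have : 0 ≤ ε * ‖z‖ := by positivity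
    linarith
  · have h2 := hR (by simpa using (not_le.1 hzR).le) (mem_wedge_of_le hc hz)
    have hz0 : z ≠ 0 := by
      rintro rfl
      have := hF.half_le_norm hz
      simp only [norm_zero] at this
      linarith
    have h3 : F z - b * z = (F z / z - b) * z := by field_simp
    rw [h3, norm_mul]
    have := mul_le_mul_of_nonneg_right h2.le (norm_nonneg z)
    linarith [le_max_right C 0]

lemma norm_hankelPath_le (hF : IsWedgeExtension κ b F) (hc : 0 < c) (r : ℝ) :
    ‖hankelPath κ c r‖ ≤ c + 2 * |r| := by
  refine (Complex.norm_le_abs_re_add_abs_im _).trans ?_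
  rw [hankelPath_re, hankelPath_im]
  have h1 : κ * |r| ≤ 1 * |r| := mul_le_mul_of_nonneg_right hF.lt_one.le (abs_nonneg r)
  have h2 : 0 ≤ κ * |r| := mul_nonneg hF.pos.le (abs_nonneg r)
  have : abs (c - κ * |r|) ≤ c + κ * |r| := by rw [abs_le]; constructor <;> linarith
  linarith

lemma polyGrowth_path (hF : IsWedgeExtension κ b F) (hc : 0 < c) :
    PolyGrowth (hankelPath κ c) := by
  refine ⟨(continuous_hankelPath κ c).measurable, c + 2, 1, fun r => ?_⟩
  refine (hF.norm_hankelPath_le hc r).trans ?_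
  nlinarith [abs_nonneg r]

lemma continuous_comp_path (hc : 0 < c) {Q : ℂ → ℂ} (hQ : DifferentiableOn ℂ Q (wedge κ)) :
    Continuous fun r => Q (hankelPath κ c r) :=
  hQ.continuousOn.comp_continuous (continuous_hankelPath κ c) fun r =>
    mem_wedge_of_le hc (hankelPath_level κ c r).ge

lemma polyGrowth_comp (hF : IsWedgeExtension κ b F) (hc : 0 < c) :
    PolyGrowth fun r => F (hankelPath κ c r) := by
  obtain ⟨C, hC0, hC⟩ := hF.lin_bound hc zero_lt_one
  refine ⟨(continuous_comp_path hc hF.diff).measurable, (1 + |b|) * (c + 2) + C, 1, fun r => ?_⟩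
  have h1 := hC _ (hankelPath_level κ c r).ge
  have h2 := hF.norm_hankelPath_le hc r
  have h3 : ‖F (hankelPath κ c r)‖ ≤ ‖F (hankelPath κ c r) - b * hankelPath κ c r‖ +
      ‖b * hankelPath κ c r‖ := by
    simpa using norm_add_le (F (hankelPath κ c r) - b * hankelPath κ c r) (b * hankelPath κ c r)
  rw [norm_mul, Complex.norm_real, Real.norm_eq_abs] at h3
  have h4 : c + 2 * |r| ≤ (c + 2) * (1 + |r|) := by nlinarith [abs_nonneg r]
  have h5 : (1 + |b|) * ‖hankelPath κ c r‖ ≤ (1 + |b|) * ((c + 2) * (1 + |r|)) :=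
    mul_le_mul_of_nonneg_left (h2.trans h4) (by positivity)
  have h6 : 0 ≤ C * |r| := by positivity
  rw [pow_one]
  linarith

lemma polyGrowth_of_bounded (hc : 0 < c) {Q : ℂ → ℂ} (hQ : DifferentiableOn ℂ Q (wedge κ)) {D : ℝ}
    (hD : ∀ z : ℂ, c ≤ z.re + κ * |z.im| → ‖Q z‖ ≤ D) :
    PolyGrowth fun r => Q (hankelPath κ c r) * hankelJac κ r := by
  refine PolyGrowth.mul ⟨(continuous_comp_path hc hQ).measurable, D, 0, fun r => ?_⟩
    ⟨measurable_hankelJac κ, 1 + |κ|, 0, fun r => ?_⟩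
  · simpa using hD _ (hankelPath_level κ c r).ge
  · simpa using norm_hankelJac_le κ r

/-- In `t z - x F z = (t - b x) z - x (F z - b z)` the first term has real part falling like `-(t -
b x) κ |r|`, and the second is `o(|r|)`. -/
lemma expDecay (hF : IsWedgeExtension κ b F) (hc : 0 < c) :
    ExpDecay (hankelPath κ c) (fun r => F (hankelPath κ c r)) {p | b * p.1 < p.2} := by
  rintro ⟨x₀, t₀⟩ hp
  simp only [mem_ofPred_eq] at hp
  set η := (t₀ - b * x₀) / 2 with hη
  have hηpos : 0 < η := by rw [hη]; linarith
  set M := |x₀| + 1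
  have hM : 0 < M := by positivity
  have hκ := hF.pos
  -- Near the base point `t - b x > η` and `|x| < M`. The error `M * ε * 2|r|` then costs half of
  -- the gain `η * κ * |r|`; the other half is the decay rate.
  set ε := η * κ / (4 * M) with hε
  have hεpos : 0 < ε := by positivity
  obtain ⟨C, hC0, hC⟩ := hF.lin_bound hc hεpos
  refine ⟨{p | |p.1| < M ∧ η < p.2 - b * p.1 ∧ p.2 - b * p.1 < 4 * η}, ?_,
    Real.exp (4 * η * c + M * (C + ε * c)), η * κ / 2, by positivity, ?_⟩
  · have : IsOpen {p : ℝ × ℝ | |p.1| < M ∧ η < p.2 - b * p.1 ∧ p.2 - b * p.1 < 4 * η} :=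
      (isOpen_lt (f := fun p : ℝ × ℝ => |p.1|) (by fun_prop) continuous_const).inter
        ((isOpen_lt (g := fun p : ℝ × ℝ => p.2 - b * p.1) continuous_const (by fun_prop)).inter
        (isOpen_lt (f := fun p : ℝ × ℝ => p.2 - b * p.1) (by fun_prop) continuous_const))
    refine this.mem_nhds ⟨?_, ?_, ?_⟩
    · simp [M]
    · simp only; linarith
    · simp only; linarith
  · rintro ⟨x, t⟩ ⟨hx, h1, h2⟩ r
    simp only at hx h1 h2 ⊢
    rw [Complex.norm_exp, ← Real.exp_add, Real.exp_le_exp]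
    set z := hankelPath κ c r with hz
    have e : (t : ℂ) * z - x * F z = ((t - b * x : ℝ) : ℂ) * z - x * (F z - b * z) := by
      push_cast; ring
    rw [e, Complex.sub_re, Complex.re_ofReal_mul, Complex.re_ofReal_mul]
    have h3 : -(x * (F z - b * z).re) ≤ M * (C + ε * ‖z‖) := by
      refine (neg_le_abs _).trans ?_
      rw [abs_mul]
      exact mul_le_mul hx.le ((Complex.abs_re_le_norm _).trans
        (hC z (hankelPath_level κ c r).ge)) (abs_nonneg _) hM.le
    have h4 := hF.norm_hankelPath_le hc r
    have h5 : M * (ε * ‖z‖) ≤ M * (ε * (c + 2 * |r|)) := by gcongr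
    have h6 : M * (ε * (2 * |r|)) = η * κ / 2 * |r| := by
      rw [hε]; field_simp; ring
    have h7 : z.re = c - κ * |r| := hankelPath_re κ c r
    rw [h7]
    have h8 : (t - b * x) * c ≤ 4 * η * c := by gcongr
    have h9 : η * (κ * |r|) ≤ (t - b * x) * (κ * |r|) := by gcongr
    nlinarith

/-- The inverse Laplace transform of `exp (-x F) Q` along the contour. -/
def inverse (_ : IsWedgeExtension κ b F) (c : ℝ) (Q : ℂ → ℂ) (p : ℝ × ℝ) : ℂ :=
  (2 * Real.pi : ℝ)⁻¹ * expIntegral (hankelPath κ c) (fun r => F (hankelPath κ c r))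
    (fun r => Q (hankelPath κ c r) * hankelJac κ r) p

lemma contDiffOn_inverse (hF : IsWedgeExtension κ b F) (hc : 0 < c) {Q : ℂ → ℂ}
    (hQ : DifferentiableOn ℂ Q (wedge κ)) {D : ℝ}
    (hD : ∀ z : ℂ, c ≤ z.re + κ * |z.im| → ‖Q z‖ ≤ D) :
    ContDiffOn ℝ (⊤ : ℕ∞) (hF.inverse c Q) {p | b * p.1 < p.2} :=
  contDiffOn_const.mul (contDiffOn_expIntegral (isOpen_lt (by fun_prop) (by fun_prop))
    (hF.polyGrowth_path hc) (hF.polyGrowth_comp hc) (hF.expDecay hc)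
    (polyGrowth_of_bounded hc hQ hD))

/-- Linear growth of `F` makes `exp (-x F) Q` grow at most exponentially in `‖z‖`, as
`laplace_inversion` permits, and `expDecay` gives the absolute convergence on the contour. -/
theorem eq_inverse (hF : IsWedgeExtension κ b F) (hc : 0 < c) {Q : ℂ → ℂ}
    (hQ : DifferentiableOn ℂ Q (wedge κ)) {D : ℝ}
    (hD : ∀ z : ℂ, c ≤ z.re + κ * |z.im| → ‖Q z‖ ≤ D) {x t : ℝ} (hxt : b * x < t)
    {g : ℝ → ℂ} (hg : Integrable fun y : ℝ => Complex.exp (-(c * y)) * g y)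
    (htr : ∀ r : ℝ, ∫ y : ℝ, Complex.exp (-((c + r * Complex.I) * y)) * g y =
      Complex.exp (-(x * F (c + r * Complex.I))) * Q (c + r * Complex.I))
    (hcont : ContinuousAt g t) : g t = hF.inverse c Q (x, t) := by
  obtain ⟨C, hC0, hC⟩ := hF.lin_bound hc zero_lt_one
  have hD0 : 0 ≤ D := (norm_nonneg _).trans (hD c (by simp))
  have e : ∀ r : ℝ, Complex.exp (t * hankelPath κ c r - x * F (hankelPath κ c r)) =
      Complex.exp (hankelPath κ c r * t) * Complex.exp (-(x * F (hankelPath κ c r))) := by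
    intro r
    rw [← Complex.exp_add]; ring_nf
  have h := laplace_inversion (κ := κ) (c := c) (B := |x| * (|b| + 1)) (t := t)
    (A := Real.exp (|x| * C) * D)
    hF.pos.le hF.lt_one hc (by positivity) (by positivity)
    (L := fun z => Complex.exp (-(x * F z)) * Q z) (((hF.diff.const_mul _).neg.cexp).mul hQ) ?_ ?_
    hg htr hcont
  · rw [h, inverse, expIntegral]
    congr with r
    rw [e]
    ring
  · intro z hz
    rw [norm_mul, Complex.norm_exp]
    have h1 : (-(x * F z)).re ≤ |x| * C + |x| * (|b| + 1) * ‖z‖ := by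
      refine (Complex.re_le_norm _).trans ?_
      rw [norm_neg, norm_mul, Complex.norm_real, Real.norm_eq_abs]
      have h3 : ‖F z‖ ≤ ‖F z - b * z‖ + ‖b * z‖ := by
        simpa using norm_add_le (F z - b * z) (b * z)
      rw [norm_mul, Complex.norm_real, Real.norm_eq_abs] at h3
      have := mul_le_mul_of_nonneg_left (h3.trans (add_le_add_left (hC z hz) _)) (abs_nonneg x)
      linarith
    calc _ ≤ Real.exp (|x| * C + |x| * (|b| + 1) * ‖z‖) * D :=
          mul_le_mul (Real.exp_le_exp.2 h1) (hD z hz) (norm_nonneg _) (Real.exp_pos _).le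
      _ = _ := by rw [Real.exp_add]; ring
  · have h0 := integrable_expIntegral (hF.polyGrowth_path hc) (hF.polyGrowth_comp hc)
      (hF.expDecay hc) (q := fun r => Q (hankelPath κ c r))
      ⟨(continuous_comp_path hc hQ).measurable, D, 0, fun r => by
        simpa using hD _ (hankelPath_level κ c r).ge⟩ (p := (x, t)) hxt
    simpa only [e, mul_assoc] using h0

end IsWedgeExtension

/-! ### Laplace transforms of measures and of convolutions -/

/-- A measure on `[0, ∞)` whose Laplace transform converges on the open right half-plane. -/
structure LaplaceFinite (ν : Measure ℝ) : Prop where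
  carrier : ν (Iio 0) = 0
  lintegral_lt : ∀ c : ℝ, 0 < c → ∫⁻ y, ENNReal.ofReal (Real.exp (-(c * y))) ∂ν < ∞

/-- The Laplace transform of a measure. -/
def laplace (ν : Measure ℝ) (z : ℂ) : ℂ := ∫ y, Complex.exp (-(z * y)) ∂ν

/-- The measure on `[0, ∞)` with a given density. -/
def densityMeasure (g : ℝ → ℝ≥0∞) : Measure ℝ := (volume.restrict (Ici 0)).withDensity g

/-- The convolution on `[0, ∞)` of a function with a measure. -/
def convMeasure (m : ℝ → ℝ≥0∞) (ν : Measure ℝ) (t : ℝ) : ℝ≥0∞ := ∫⁻ y in Icc 0 t, m (t - y) ∂ν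

lemma LaplaceFinite.integrable {ν : Measure ℝ} (hν : LaplaceFinite ν) {z : ℂ} (hz : 0 < z.re) :
    Integrable (fun y : ℝ => Complex.exp (-(z * y))) ν := by
  refine ⟨Continuous.aestronglyMeasurable (by fun_prop), ?_⟩
  rw [hasFiniteIntegral_iff_norm]
  simpa [Complex.norm_exp] using hν.lintegral_lt z.re hz

lemma LaplaceFinite.measure_Icc_lt {ν : Measure ℝ} (hν : LaplaceFinite ν) (t : ℝ) :
    ν (Icc 0 t) < ∞ := by
  have h := mul_meas_ge_le_lintegral (μ := ν)
    (f := fun y : ℝ => ENNReal.ofReal (Real.exp (-(1 * y)))) (by fun_prop)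
    (ENNReal.ofReal (Real.exp (-(1 * t))))
  have h2 := h.trans_lt (hν.lintegral_lt 1 one_pos)
  have h3 : ν {y | ENNReal.ofReal (Real.exp (-(1 * t))) ≤ ENNReal.ofReal (Real.exp (-(1 * y)))}
      < ∞ := by
    by_contra! h4
    rw [top_le_iff.1 h4, ENNReal.mul_top] at h2
    · exact lt_irrefl _ h2
    · simpa using Real.exp_pos _
  refine (measure_mono fun y hy => ?_).trans_lt h3
  exact ENNReal.ofReal_le_ofReal (Real.exp_le_exp.2 (by linarith [hy.2]))

lemma lintegral_densityMeasure {g h : ℝ → ℝ≥0∞} (hg : Measurable g) (hh : Measurable h) :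
    ∫⁻ y, h y ∂(densityMeasure g) = ∫⁻ y in Ici 0, g y * h y := by
  rw [densityMeasure, lintegral_withDensity_eq_lintegral_mul _ hg hh]; rfl

lemma densityMeasure_Iio (g : ℝ → ℝ≥0∞) : densityMeasure g (Iio 0) = 0 := by
  refine withDensity_absolutelyContinuous _ _ ?_
  rw [Measure.restrict_apply measurableSet_Iio]
  have : Iio (0 : ℝ) ∩ Ici 0 = ∅ := by ext; simp
  simp [this]

lemma measurable_convMeasure {m : ℝ → ℝ≥0∞} (hm : Measurable m) (ν : Measure ℝ) [SFinite ν] :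
    Measurable (convMeasure m ν) := by
  have : convMeasure m ν = fun t => ∫⁻ y, (Icc 0 t).indicator (fun y => m (t - y)) y ∂ν := by
    funext t; rw [convMeasure, lintegral_indicator measurableSet_Icc]
  rw [this]
  refine Measurable.lintegral_prod_right' (f := fun p : ℝ × ℝ =>
    (Icc 0 p.1).indicator (fun y => m (p.1 - y)) p.2) ?_
  have h2 : MeasurableSet {p : ℝ × ℝ | 0 ≤ p.2 ∧ p.2 ≤ p.1} :=
    (measurableSet_le measurable_const measurable_snd).inter
      (measurableSet_le measurable_snd measurable_fst)
  exact Measurable.indicator (f := fun p : ℝ × ℝ => m (p.1 - p.2)) (by fun_prop) h2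

instance (g : ℝ → ℝ≥0∞) : SFinite (densityMeasure g) := by
  unfold densityMeasure; infer_instance

/-- Tonelli and a translation. Identifying the pointwise convolution with `Measure.conv` makes its
Laplace transform a product, without any regularity of `ν`. -/
lemma densityMeasure_convMeasure {m : ℝ → ℝ≥0∞} (hm : Measurable m) {ν : Measure ℝ} [SFinite ν]
    (hν : ν (Iio 0) = 0) :
    densityMeasure (convMeasure m ν) = (densityMeasure m).conv ν := by
  have hνae : ∀ᵐ y ∂ν, 0 ≤ y := by
    rw [ae_iff]; simpa [Iio] using hν
  refine Measure.ext_of_lintegral _ fun h hh => ?_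
  rw [lintegral_densityMeasure (measurable_convMeasure hm ν) hh,
    Measure.conv_comm, Measure.lintegral_conv hh]
  have e1 : ∀ t, (Ici (0 : ℝ)).indicator (fun t => convMeasure m ν t * h t) t =
      ∫⁻ y, {p : ℝ × ℝ | 0 ≤ p.2 ∧ p.2 ≤ p.1}.indicator
        (fun p => m (p.1 - p.2) * h p.1) (t, y) ∂ν := by
    intro t
    by_cases ht : 0 ≤ t
    · rw [indicator_of_mem (show t ∈ Ici (0 : ℝ) from ht), convMeasure,
        ← lintegral_mul_const _ (by fun_prop), ← lintegral_indicator measurableSet_Icc]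
      rfl
    · rw [indicator_of_notMem (by simpa using ht)]
      symm
      convert lintegral_zero with y
      refine indicator_of_notMem ?_ _
      rintro ⟨h1, h2⟩
      simp only at h1 h2
      linarith
  have h2 : MeasurableSet {p : ℝ × ℝ | 0 ≤ p.2 ∧ p.2 ≤ p.1} :=
    (measurableSet_le measurable_const measurable_snd).inter
      (measurableSet_le measurable_snd measurable_fst)
  rw [← lintegral_indicator measurableSet_Ici, lintegral_congr e1,
    lintegral_lintegral_swap (f := fun t y => {p : ℝ × ℝ | 0 ≤ p.2 ∧ p.2 ≤ p.1}.indicator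
        (fun p => m (p.1 - p.2) * h p.1) (t, y))
      (Measurable.aemeasurable (Measurable.indicator (f := fun p : ℝ × ℝ =>
        m (p.1 - p.2) * h p.1) (by fun_prop) h2))]
  refine lintegral_congr_ae ?_
  filter_upwards [hνae] with y hy
  rw [lintegral_densityMeasure hm (by fun_prop), ← lintegral_indicator measurableSet_Ici,
    ← lintegral_add_right_eq_self (fun t => {p : ℝ × ℝ | 0 ≤ p.2 ∧ p.2 ≤ p.1}.indicator
        (fun p => m (p.1 - p.2) * h p.1) (t, y)) y]
  refine lintegral_congr fun s => ?_
  by_cases hs : 0 ≤ s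
  · rw [indicator_of_mem (show s ∈ Ici (0 : ℝ) from hs), indicator_of_mem]
    · simp [add_comm]
    · exact ⟨hy, by simpa using hs⟩
  · rw [indicator_of_notMem (show s ∉ Ici (0 : ℝ) by simpa using hs), indicator_of_notMem]
    rintro ⟨-, h1⟩
    simp only at h1
    exact hs (by linarith)

lemma laplaceFinite_convMeasure {m : ℝ → ℝ≥0∞} (hm : Measurable m)
    (hmL : LaplaceFinite (densityMeasure m)) {ν : Measure ℝ} [SFinite ν] (hν : LaplaceFinite ν) :
    LaplaceFinite (densityMeasure (convMeasure m ν)) := by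
  refine ⟨densityMeasure_Iio _, fun c hc => ?_⟩
  rw [densityMeasure_convMeasure hm hν.carrier, Measure.lintegral_conv (by fun_prop)]
  have : ∀ x : ℝ, ∫⁻ y, ENNReal.ofReal (Real.exp (-(c * (x + y)))) ∂ν =
      ENNReal.ofReal (Real.exp (-(c * x))) * ∫⁻ y, ENNReal.ofReal (Real.exp (-(c * y))) ∂ν := by
    intro x
    rw [← lintegral_const_mul _ (by fun_prop)]
    refine lintegral_congr fun y => ?_
    rw [← ENNReal.ofReal_mul (Real.exp_pos _).le, ← Real.exp_add]
    ring_nf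
  rw [lintegral_congr this, lintegral_mul_const _ (by fun_prop)]
  exact ENNReal.mul_lt_top (hmL.lintegral_lt c hc) (hν.lintegral_lt c hc)

lemma laplace_convMeasure {m : ℝ → ℝ≥0∞} (hm : Measurable m) {ν : Measure ℝ} [SFinite ν]
    (hν : LaplaceFinite ν) (z : ℂ) :
    laplace (densityMeasure (convMeasure m ν)) z = laplace (densityMeasure m) z * laplace ν z := by
  rw [laplace, densityMeasure_convMeasure hm hν.carrier, Measure.conv,
    integral_map (by fun_prop) (Continuous.aestronglyMeasurable (by fun_prop)), laplace, laplace,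
    ← integral_prod_mul]
  refine integral_congr_ae (Eventually.of_forall fun p => ?_)
  simp only
  rw [← Complex.exp_add]
  push_cast
  ring_nf

lemma LaplaceFinite.ae_lt_top {g : ℝ → ℝ≥0∞} (hg : Measurable g)
    (h : LaplaceFinite (densityMeasure g)) : ∀ᵐ y ∂volume.restrict (Ici 0), g y < ∞ := by
  have h1 := h.lintegral_lt 1 one_pos
  rw [lintegral_densityMeasure hg (by fun_prop)] at h1
  filter_upwards [MeasureTheory.ae_lt_top (by fun_prop) h1.ne] with y hy
  by_contra! h2
  rw [top_le_iff.1 h2, ENNReal.top_mul] at hy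
  · exact lt_irrefl _ hy
  · simpa using Real.exp_pos _

lemma laplace_densityMeasure {g : ℝ → ℝ≥0∞} (hg : Measurable g)
    (h : LaplaceFinite (densityMeasure g)) {z : ℂ} (hz : 0 < z.re) :
    Integrable (fun y : ℝ => Complex.exp (-(z * y)) *
      (Ici (0 : ℝ)).indicator (fun y => ((g y).toReal : ℂ)) y) ∧
    ∫ y : ℝ, Complex.exp (-(z * y)) * (Ici (0 : ℝ)).indicator (fun y => ((g y).toReal : ℂ)) y =
      laplace (densityMeasure g) z := by
  have hae := h.ae_lt_top hg
  have e : (fun y : ℝ => Complex.exp (-(z * y)) *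
      (Ici (0 : ℝ)).indicator (fun y => ((g y).toReal : ℂ)) y) =
      (Ici (0 : ℝ)).indicator (fun y => (g y).toReal • Complex.exp (-(z * y))) := by
    funext y
    by_cases hy : y ∈ Ici (0 : ℝ)
    · rw [indicator_of_mem hy, indicator_of_mem hy, Complex.real_smul, mul_comm]
    · rw [indicator_of_notMem hy, indicator_of_notMem hy, mul_zero]
  have hi := h.integrable hz
  rw [densityMeasure, integrable_withDensity_iff_integrable_smul' hg hae] at hi
  rw [e]
  refine ⟨(integrable_indicator_iff measurableSet_Ici).2 hi, ?_⟩
  rw [integral_indicator measurableSet_Ici, laplace, densityMeasure,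
    integral_withDensity_eq_integral_toReal_smul hg hae]

/-- The density is continued by `0` to the negative axis to fit `eq_inverse`; for `t > 0` this does
not affect continuity at `t`. -/
theorem IsWedgeExtension.toReal_eq_inverse {κ b c : ℝ} {F : ℂ → ℂ} (hF : IsWedgeExtension κ b F)
    (hc : 0 < c) {Q : ℂ → ℂ} (hQ : DifferentiableOn ℂ Q (wedge κ)) {D : ℝ}
    (hD : ∀ z : ℂ, c ≤ z.re + κ * |z.im| → ‖Q z‖ ≤ D) {x t : ℝ} (hxt : b * x < t)
    {g : ℝ → ℝ≥0∞} (hg : Measurable g) (hgL : LaplaceFinite (densityMeasure g))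
    (htr : ∀ z : ℂ, 0 < z.re → laplace (densityMeasure g) z = Complex.exp (-(x * F z)) * Q z)
    (ht : 0 < t) (hcont : ContinuousAt (fun s => (g s).toReal) t) :
    ((g t).toReal : ℂ) = hF.inverse c Q (x, t) := by
  have hmem : Ici (0 : ℝ) ∈ 𝓝 t := Ici_mem_nhds ht
  have h := hF.eq_inverse hc hQ hD hxt
    (g := (Ici (0 : ℝ)).indicator fun y => ((g y).toReal : ℂ)) ?_ ?_ ?_
  · rw [indicator_of_mem (show t ∈ Ici (0 : ℝ) from ht.le)] at h
    exact h
  · exact (laplace_densityMeasure hg hgL (z := c) (by simpa using hc)).1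
  · intro r
    have hre : 0 < ((c : ℂ) + r * Complex.I).re := by simpa using hc
    rw [(laplace_densityMeasure hg hgL hre).2, htr _ hre]
  · have h2 : ContinuousAt (fun s => ((g s).toReal : ℂ)) t :=
      Complex.continuous_ofReal.continuousAt.comp hcont
    refine h2.congr ?_
    filter_upwards [hmem] with s hs
    rw [indicator_of_mem hs]

/-! ### Tails and densities: from points of continuity to all points -/

lemma antitone_measure_Ioi (ν : Measure ℝ) : Antitone fun t => ν (Ioi t) :=
  fun _ _ h => measure_mono (Ioi_subset_Ioi h)

lemma tendsto_measure_Ioi_nhdsGT (ν : Measure ℝ) (t : ℝ) :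
    Tendsto (fun s => ν (Ioi s)) (𝓝[>] t) (𝓝 (ν (Ioi t))) := by
  refine tendsto_order.2 ⟨fun a ha => ?_, fun a ha => ?_⟩
  · have h1 : ⋃ n : ℕ, Ioi (t + 1 / ((n : ℝ) + 1)) = Ioi t := by
      ext y
      simp only [mem_iUnion, mem_Ioi]
      constructor
      · rintro ⟨n, hn⟩
        have : (0 : ℝ) < 1 / ((n : ℝ) + 1) := by positivity
        linarith
      · intro hy
        obtain ⟨n, hn⟩ := exists_nat_one_div_lt (sub_pos.2 hy)
        exact ⟨n, by linarith⟩
    have hm : Monotone fun n : ℕ => Ioi (t + 1 / ((n : ℝ) + 1)) := by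
      intro i j hij
      refine Ioi_subset_Ioi (add_le_add_right ?_ t)
      exact Nat.one_div_le_one_div hij
    have h2 := tendsto_measure_iUnion_atTop (μ := ν) hm
    rw [h1] at h2
    obtain ⟨n, hn⟩ := (h2.eventually_const_lt ha).exists
    have hpos : (0 : ℝ) < 1 / ((n : ℝ) + 1) := by positivity
    filter_upwards [Ioo_mem_nhdsGT (show t < t + 1 / ((n : ℝ) + 1) by linarith)] with s hs
    exact lt_of_lt_of_le hn (antitone_measure_Ioi ν hs.2.le)
  · filter_upwards [self_mem_nhdsWithin] with s hs
    exact lt_of_le_of_lt (antitone_measure_Ioi ν (le_of_lt hs)) ha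

/-- A tail that agrees with a continuous function where it is continuous agrees with it
everywhere. -/
lemma measure_Ioi_toReal_eq {ν : Measure ℝ} {a : ℝ} (hfin : ∀ t, a < t → ν (Ioi t) ≠ ∞)
    {h : ℝ → ℝ} (hc : ContinuousOn h (Ioi a))
    (heq : ∀ t, a < t → ContinuousAt (fun s => (ν (Ioi s)).toReal) t → (ν (Ioi t)).toReal = h t)
    {t : ℝ} (ht : a < t) : (ν (Ioi t)).toReal = h t := by
  -- A monotone function has only countably many discontinuities, so its points of continuity
  -- accumulate at `t` from the right. Both sides are right-continuous, hence equal at `t`.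
  have hS := (antitone_measure_Ioi ν).countable_not_continuousAt
  have h1 : Tendsto (fun s => (ν (Ioi s)).toReal) (𝓝[>] t) (𝓝 (ν (Ioi t)).toReal) :=
    (ENNReal.tendsto_toReal (hfin t ht)).comp (tendsto_measure_Ioi_nhdsGT ν t)
  have h2 : Tendsto h (𝓝[>] t) (𝓝 (h t)) :=
    (hc.continuousAt (Ioi_mem_nhds ht)).tendsto.mono_left nhdsWithin_le_nhds
  refine tendsto_nhds_unique_of_frequently_eq h1 h2 ?_
  rw [(nhdsGT_basis t).frequently_iff]
  intro u hu
  obtain ⟨s, hs1, hs2⟩ := (hS.dense_compl ℝ).exists_between hu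
  refine ⟨s, hs2, heq s (ht.trans hs2.1) ?_⟩
  have : ContinuousAt (fun t => ν (Ioi t)) s := by simpa using hs1
  exact (ENNReal.tendsto_toReal (hfin s (ht.trans hs2.1))).comp this

/-- A finite measure whose distribution function is `C¹` on `(a, ∞)` has a density there. -/
lemma restrict_eq_withDensity_of_hasDerivAt {ν : Measure ℝ} [IsFiniteMeasure ν] {a : ℝ}
    {h k : ℝ → ℝ} (hk : ContinuousOn k (Ioi a)) (hh : ∀ t, a < t → HasDerivAt h (k t) t)
    (heq : ∀ t, a < t → (ν (Ioi t)).toReal = - h t) {c : ℝ} (hc : a < c) :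
    ν.restrict (Ioi c) = (volume.restrict (Ioi c)).withDensity fun t => ENNReal.ofReal (k t) := by
  have hmono : MonotoneOn h (Ioi a) := by
    intro s hs t ht hst
    have h1 := ENNReal.toReal_mono (measure_ne_top ν _) (antitone_measure_Ioi ν hst)
    simp only at h1
    rw [heq s hs, heq t ht] at h1
    linarith
  have hk0 : ∀ t, a < t → 0 ≤ k t := by
    intro t ht
    have h1 := hmono.derivWithin_nonneg (x := t)
    rwa [derivWithin_of_isOpen isOpen_Ioi ht, (hh t ht).deriv] at h1
  refine Measure.ext_of_Ioc _ _ fun s t _ => ?_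
  rw [withDensity_apply _ measurableSet_Ioc, Measure.restrict_restrict measurableSet_Ioc,
    Measure.restrict_apply measurableSet_Ioc, Ioc_inter_Ioi]
  set u := max s c
  have hu : a < u := hc.trans_le (le_max_right _ _)
  rcases le_or_gt t u with htu | htu
  · simp [Ioc_eq_empty (not_lt.2 htu)]
  have hcont : ContinuousOn k (Icc u t) := hk.mono fun y hy => hu.trans_le hy.1
  have hint : IntervalIntegrable k volume u t := by
    refine ContinuousOn.intervalIntegrable ?_
    rwa [uIcc_of_le htu.le]
  have h1 : ∫ y in u..t, k y = h t - h u :=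
    intervalIntegral.integral_eq_sub_of_hasDerivAt (fun y hy => by
      rw [uIcc_of_le htu.le] at hy
      exact hh y (hu.trans_le hy.1)) hint
  rw [← ofReal_integral_eq_lintegral_ofReal
    ((intervalIntegrable_iff_integrableOn_Ioc_of_le htu.le).1 hint)
    ((ae_restrict_iff' measurableSet_Ioc).2 (Eventually.of_forall fun y hy => hk0 y (hu.trans hy.1))),
    ← intervalIntegral.integral_of_le htu.le, h1]
  have h2 : Ioc u t = Ioi u \ Ioi t := by ext; simp
  rw [h2, measure_sdiff (Ioi_subset_Ioi htu.le) measurableSet_Ioi.nullMeasurableSet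
    (measure_ne_top _ _), ← ENNReal.ofReal_toReal (measure_ne_top ν (Ioi u)),
    ← ENNReal.ofReal_toReal (measure_ne_top ν (Ioi t)), ← ENNReal.ofReal_sub _ ENNReal.toReal_nonneg,
    heq u hu, heq t (hu.trans htu)]
  ring_nf

/-! ### Continuity of convolutions -/

/-- The function `m` may be singular at `0` and `ν` is uncontrolled on the left. Cutting at `c`
leaves one good factor in each part: `t - y ≥ t - c` in the first, a density in the second. There `s
= t - y` moves the dependence on `t` from the singular `m` to `k`. -/
lemma convMeasure_split {m : ℝ → ℝ≥0∞} (hm : Measurable m) {ν : Measure ℝ} {k : ℝ → ℝ≥0∞}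
    (hk : Measurable k) {c t : ℝ} (hc : 0 ≤ c) (hct : c ≤ t)
    (hν : ν.restrict (Ioi c) = (volume.restrict (Ioi c)).withDensity k) :
    convMeasure m ν t = (∫⁻ y in Icc 0 c, m (t - y) ∂ν) +
      ∫⁻ s, (Ico 0 (t - c)).indicator (fun s => m s * k (t - s)) s := by
  have h1 : Icc 0 t = Icc 0 c ∪ Ioc c t := (Icc_union_Ioc_eq_Icc hc hct).symm
  rw [convMeasure, h1, lintegral_union measurableSet_Ioc
    (Set.disjoint_left.2 fun y hy hy' => not_lt.2 hy.2 hy'.1)]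
  congr 1
  rw [← Measure.restrict_restrict_of_subset (show Ioc c t ⊆ Ioi c from Ioc_subset_Ioi_self), hν,
    restrict_withDensity measurableSet_Ioc,
    Measure.restrict_restrict_of_subset Ioc_subset_Ioi_self,
    lintegral_withDensity_eq_lintegral_mul _ hk (by fun_prop),
    ← lintegral_indicator measurableSet_Ioc, ← lintegral_sub_left_eq_self _ t]
  refine lintegral_congr fun s => ?_
  by_cases hs : s ∈ Ico 0 (t - c)
  · rw [indicator_of_mem hs, indicator_of_mem (show t - s ∈ Ioc c t from
      ⟨by linarith [hs.2], by linarith [hs.1]⟩)]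
    simp [mul_comm]
  · rw [indicator_of_notMem hs, indicator_of_notMem]
    rintro ⟨h2, h3⟩
    exact hs ⟨by linarith, by linarith⟩

/-- Dominated convergence in both parts of the splitting, with `c` strictly between `a` and `t`. The
dominating functions are the constant `m η` on `[0, c]`, which has finite mass, and `m` times the
maximum of `k` on a compact interval, `m` being integrable near `0`. -/
lemma continuousAt_convMeasure {m : ℝ → ℝ≥0∞} (hm : Measurable m) (hanti : Antitone m)
    (hmc : ∀ s, 0 < s → ContinuousAt m s) (hmf : ∀ s, 0 < s → m s ≠ ∞)
    (hmL : LaplaceFinite (densityMeasure m)) {ν : Measure ℝ} (hνL : LaplaceFinite ν)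
    {k : ℝ → ℝ≥0∞} (hk : Measurable k) {a : ℝ} (ha : 0 ≤ a) (hkc : ContinuousOn k (Ioi a))
    (hkf : ∀ y, a < y → k y ≠ ∞)
    (hν : ∀ c, a < c → ν.restrict (Ioi c) = (volume.restrict (Ioi c)).withDensity k)
    {t : ℝ} (ht : a < t) : convMeasure m ν t ≠ ∞ ∧ ContinuousAt (convMeasure m ν) t := by
  set c := (a + t) / 2 with hc
  have hac : a < c := by rw [hc]; linarith
  have hct : c < t := by rw [hc]; linarith
  set η := (t - c) / 2 with hη
  have hηpos : 0 < η := by rw [hη]; linarith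
  have hnhds : ∀ᶠ u in 𝓝 t, c + η < u ∧ u < t + η :=
    Ioo_mem_nhds (by linarith) (by linarith)
  have hsplit : ∀ u, c ≤ u → _ := fun u hu =>
    convMeasure_split hm hk (ha.trans hac.le) hu (hν c hac)
  obtain ⟨y₀, hy₀, hmax⟩ := (isCompact_Icc (a := c) (b := t + η)).exists_isMaxOn
    (nonempty_Icc.2 (by linarith)) (hkc.mono fun y hy => hac.trans_le hy.1)
  have hA : ∫⁻ _ in Icc 0 c, m η ∂ν ≠ ∞ := by
    rw [setLIntegral_const]
    exact ENNReal.mul_ne_top (hmf η hηpos) (hνL.measure_Icc_lt c).ne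
  have hBm : ∫⁻ s in Icc 0 (t - c + η), m s ≠ ∞ := by
    have h1 := hmL.measure_Icc_lt (t - c + η)
    rw [densityMeasure, withDensity_apply _ measurableSet_Icc,
      Measure.restrict_restrict measurableSet_Icc,
      inter_eq_left.2 Icc_subset_Ici_self] at h1
    exact h1.ne
  have hB : ∫⁻ s, (Icc 0 (t - c + η)).indicator m s * k y₀ ≠ ∞ := by
    rw [lintegral_mul_const _ (hm.indicator measurableSet_Icc),
      lintegral_indicator measurableSet_Icc]
    exact ENNReal.mul_ne_top hBm (hkf y₀ (hac.trans_le hy₀.1))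
  have bA : ∀ u, c + η < u → ∀ᵐ y ∂ν.restrict (Icc 0 c), m (u - y) ≤ m η := fun u hu =>
    (ae_restrict_iff' measurableSet_Icc).2 (Eventually.of_forall fun y hy =>
      hanti (by linarith [hy.2]))
  have bB : ∀ u, u < t + η → ∀ s, (Ico 0 (u - c)).indicator (fun s => m s * k (u - s)) s ≤
      (Icc 0 (t - c + η)).indicator m s * k y₀ := by
    intro u hu s
    by_cases hs : s ∈ Ico 0 (u - c)
    swap
    · rw [indicator_of_notMem hs]; exact zero_le
    rw [indicator_of_mem hs, indicator_of_mem (show s ∈ Icc 0 (t - c + η) from ⟨hs.1, by linarith [hs.2]⟩)]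
    gcongr
    exact hmax ⟨by linarith [hs.2], by linarith [hs.1]⟩
  constructor
  · rw [hsplit t hct.le]
    refine ENNReal.add_ne_top.2 ⟨ne_top_of_le_ne_top hA (lintegral_mono_ae (bA t (by linarith))),
      ne_top_of_le_ne_top hB (lintegral_mono (bB t (by linarith)))⟩
  · rw [ContinuousAt, hsplit t hct.le]
    refine Tendsto.congr' (f₁ := fun u => (∫⁻ y in Icc 0 c, m (u - y) ∂ν) +
      ∫⁻ s, (Ico 0 (u - c)).indicator (fun s => m s * k (u - s)) s) ?_ (Tendsto.add ?_ ?_)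
    · filter_upwards [hnhds] with u hu
      rw [hsplit u (by linarith)]
    · refine tendsto_lintegral_filter_of_dominated_convergence (fun _ => m η)
        (Eventually.of_forall fun u => by fun_prop) (hnhds.mono fun u hu => bA u hu.1) hA ?_
      refine (ae_restrict_iff' measurableSet_Icc).2 (Eventually.of_forall fun y hy => ?_)
      have h1 : ContinuousAt (fun u => u - y) t := by fun_prop
      exact ContinuousAt.comp (f := fun u => u - y) (hmc _ (by linarith [hy.2])) h1
    · refine tendsto_lintegral_filter_of_dominated_convergence _
        (Eventually.of_forall fun u => (Measurable.mul hm (by fun_prop)).indicator measurableSet_Ico)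
        (hnhds.mono fun u hu => Eventually.of_forall (bB u hu.2)) hB ?_
      -- Two points are discarded: `s = t - c`, where the moving indicator jumps, and `s = 0`, where
      -- `m` may be infinite.
      have hne : ∀ r : ℝ, ∀ᵐ s : ℝ, s ≠ r := fun r => by
        simp [ae_iff]
      filter_upwards [hne 0, hne (t - c)] with s hs0 hs1
      by_cases hs : 0 < s ∧ s < t - c
      · rw [indicator_of_mem (show s ∈ Ico 0 (t - c) from ⟨hs.1.le, hs.2⟩)]
        have h1 : ContinuousAt (fun u => u - s) t := by fun_prop
        have h2 : ContinuousAt (fun u => k (u - s)) t :=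
          ContinuousAt.comp (f := fun u => u - s)
            (hkc.continuousAt (Ioi_mem_nhds (by linarith [hs.2]))) h1
        refine (ENNReal.Tendsto.const_mul h2 (Or.inr (hmf s hs.1))).congr' ?_
        filter_upwards [Ioi_mem_nhds (show s + c < t by linarith [hs.2])] with u hu
        have hu : s + c < u := hu
        rw [indicator_of_mem (show s ∈ Ico 0 (u - c) from ⟨hs.1.le, by linarith⟩)]
      · have hs' : s < 0 ∨ t - c < s := by
          by_contra! h
          exact hs ⟨lt_of_le_of_ne h.1 (Ne.symm hs0), lt_of_le_of_ne h.2 hs1⟩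
        rw [indicator_of_notMem (fun h => hs ⟨lt_of_le_of_ne h.1 (Ne.symm hs0), h.2⟩)]
        refine tendsto_const_nhds.congr' ?_
        rcases hs' with hs' | hs'
        · exact Eventually.of_forall fun u =>
            (indicator_of_notMem (fun h => not_lt.2 h.1 hs') _).symm
        · filter_upwards [Iio_mem_nhds (show t < s + c by linarith)] with u hu
          have hu : u < s + c := hu
          rw [indicator_of_notMem (fun h => by linarith [h.2])]

lemma conv_eq_convMeasure {f g : ℝ → ℝ≥0∞} (hf : Measurable f) (hg : Measurable g) (t : ℝ) :
    conv f g t = convMeasure f (densityMeasure g) t := by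
  rw [conv, convMeasure, densityMeasure, restrict_withDensity measurableSet_Icc,
    Measure.restrict_restrict measurableSet_Icc,
    inter_eq_left.2 Icc_subset_Ici_self,
    lintegral_withDensity_eq_lintegral_mul _ hg (by fun_prop),
    ← lintegral_indicator measurableSet_Icc, ← lintegral_indicator measurableSet_Icc,
    ← lintegral_sub_left_eq_self _ t]
  refine lintegral_congr fun s => ?_
  by_cases hs : s ∈ Icc 0 t
  · rw [indicator_of_mem hs, indicator_of_mem (show t - s ∈ Icc 0 t from
      ⟨by linarith [hs.2], by linarith [hs.1]⟩)]
    simp [mul_comm]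
  · rw [indicator_of_notMem hs, indicator_of_notMem]
    rintro ⟨h2, h3⟩
    exact hs ⟨by linarith, by linarith⟩

/-! ### The tail of a Lévy measure and its transform -/

namespace IsLevyMeasure

variable {μ : Measure ℝ}

lemma levyTail_ne_top (hμ : IsLevyMeasure μ) {t : ℝ} (ht : 0 < t) : levyTail μ t ≠ ∞ := by
  have h := mul_meas_ge_le_lintegral (μ := μ) (f := fun y : ℝ => ENNReal.ofReal (min y 1))
    (by fun_prop) (ENNReal.ofReal (min t 1))
  have h2 := h.trans_lt hμ.integrable_min
  have h3 : levyTail μ t ≤ μ {y | ENNReal.ofReal (min t 1) ≤ ENNReal.ofReal (min y 1)} :=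
    measure_mono fun y hy => ENNReal.ofReal_le_ofReal (min_le_min_right 1 (le_of_lt hy))
  refine ne_top_of_le_ne_top (fun h4 => ?_) h3
  rw [h4, ENNReal.mul_top] at h2
  · exact lt_irrefl _ h2
  · simpa using ht

lemma sigmaFinite (hμ : IsLevyMeasure μ) : SigmaFinite μ := by
  refine ⟨⟨⟨fun n : ℕ => Iic 0 ∪ Ioi (1 / ((n : ℝ) + 1)), fun _ => trivial, fun n => ?_, ?_⟩⟩⟩
  · refine (measure_union_le _ _).trans_lt ?_
    rw [hμ.carrier, zero_add]
    exact (hμ.levyTail_ne_top (by positivity)).lt_top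
  · refine eq_univ_of_forall fun y => mem_iUnion.2 ?_
    rcases le_or_gt y 0 with hy | hy
    · exact ⟨0, Or.inl hy⟩
    · obtain ⟨n, hn⟩ := exists_nat_one_div_lt hy
      exact ⟨n, Or.inr hn⟩

lemma antitone_levyTail (μ : Measure ℝ) : Antitone (levyTail μ) := antitone_measure_Ioi μ

lemma measurable_levyTail (μ : Measure ℝ) : Measurable (levyTail μ) :=
  (antitone_levyTail μ).measurable

lemma measurableSet_below : MeasurableSet {p : ℝ × ℝ | 0 ≤ p.2 ∧ p.2 < p.1} :=
  (measurableSet_le measurable_const measurable_snd).inter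
    (measurableSet_lt measurable_snd measurable_fst)

/-- Seen as a marginal of `μ ⊗ dt` on `0 ≤ t < y`, the tail can be integrated by Fubini: an integral
against it becomes one against `μ` of integrals over `[0, y)`, and for `exp (-z t)` these are `(1 -
exp (-z y)) / z`. -/
lemma densityMeasure_levyTail [SFinite μ] :
    densityMeasure (levyTail μ) =
      ((μ.prod volume).restrict {p : ℝ × ℝ | 0 ≤ p.2 ∧ p.2 < p.1}).map Prod.snd := by
  refine Measure.ext_of_lintegral _ fun h hh => ?_
  have hm : Measurable ({p : ℝ × ℝ | 0 ≤ p.2 ∧ p.2 < p.1}.indicator fun p => h p.2) :=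
    Measurable.indicator (by fun_prop) measurableSet_below
  rw [lintegral_densityMeasure (measurable_levyTail μ) hh, lintegral_map hh measurable_snd,
    ← lintegral_indicator measurableSet_below, lintegral_prod_symm _ hm.aemeasurable,
    ← lintegral_indicator measurableSet_Ici]
  refine lintegral_congr fun t => ?_
  by_cases ht : 0 ≤ t
  · rw [indicator_of_mem (show t ∈ Ici (0 : ℝ) from ht), mul_comm, levyTail,
      ← setLIntegral_const, ← lintegral_indicator measurableSet_Ioi]
    refine lintegral_congr fun y => ?_
    by_cases hy : t < y
    · rw [indicator_of_mem (show y ∈ Ioi t from hy), indicator_of_mem]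
      exact ⟨ht, hy⟩
    · rw [indicator_of_notMem (show y ∉ Ioi t from hy), indicator_of_notMem]
      exact fun h => hy h.2
  · rw [indicator_of_notMem (show t ∉ Ici (0 : ℝ) from ht)]
    symm
    convert lintegral_zero with y
    exact indicator_of_notMem (fun h => ht h.1) _

lemma ae_pos (hμ : IsLevyMeasure μ) : ∀ᵐ y ∂μ, 0 < y := by
  rw [ae_iff]
  simpa [Iic] using hμ.carrier

/-- The integral is at most `y` and at most `1 / c`; the first bound is used for `y ≤ 1`, the second
for `y ≥ 1`. The form `min y 1` matches the integrability of a Lévy measure. -/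
lemma lintegral_exp_Ico_le {c y : ℝ} (hc : 0 < c) :
    ∫⁻ t in Ico 0 y, ENNReal.ofReal (Real.exp (-(c * t))) ≤
      ENNReal.ofReal (max 1 (1 / c)) * ENNReal.ofReal (min y 1) := by
  rcases le_or_gt y 0 with hy | hy
  · simp [Ico_eq_empty (not_lt.2 hy)]
  rw [← ENNReal.ofReal_mul (by positivity)]
  rcases le_total y 1 with h1 | h1
  · rw [min_eq_left h1]
    calc _ ≤ ∫⁻ _ in Ico 0 y, 1 := by
          refine setLIntegral_mono measurable_const fun t ht => ?_
          rw [ENNReal.ofReal_le_one, Real.exp_le_one_iff]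
          have := mul_nonneg hc.le ht.1
          linarith
      _ = ENNReal.ofReal y := by simp
      _ ≤ _ := ENNReal.ofReal_le_ofReal (le_mul_of_one_le_left hy.le (le_max_left _ _))
  · rw [min_eq_right h1, mul_one]
    have h2 : IntegrableOn (fun t : ℝ => Real.exp (-(c * t))) (Ioi 0) := by
      simpa [neg_mul] using exp_neg_integrableOn_Ioi 0 hc
    calc _ ≤ ∫⁻ t in Ici 0, ENNReal.ofReal (Real.exp (-(c * t))) :=
          lintegral_mono_set fun t ht => ht.1
      _ = ∫⁻ t in Ioi 0, ENNReal.ofReal (Real.exp (-(c * t))) := by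
          rw [Measure.restrict_congr_set Ioi_ae_eq_Ici]
      _ = ENNReal.ofReal (1 / c) := by
          rw [← ofReal_integral_eq_lintegral_ofReal h2
            (Eventually.of_forall fun _ => (Real.exp_pos _).le)]
          congr 1
          have := integral_exp_mul_Ioi (neg_lt_zero.2 hc) 0
          simpa using this
      _ ≤ _ := ENNReal.ofReal_le_ofReal (le_max_right _ _)

lemma laplaceFinite_levyTail (hμ : IsLevyMeasure μ) :
    LaplaceFinite (densityMeasure (levyTail μ)) := by
  have := hμ.sigmaFinite
  refine ⟨densityMeasure_Iio _, fun c hc => ?_⟩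
  have hm : Measurable ({p : ℝ × ℝ | 0 ≤ p.2 ∧ p.2 < p.1}.indicator
      fun p => ENNReal.ofReal (Real.exp (-(c * p.2)))) :=
    Measurable.indicator (by fun_prop) measurableSet_below
  rw [densityMeasure_levyTail, lintegral_map (by fun_prop) measurable_snd,
    ← lintegral_indicator measurableSet_below, lintegral_prod _ hm.aemeasurable]
  have h1 : ∀ y, ∫⁻ t, ({p : ℝ × ℝ | 0 ≤ p.2 ∧ p.2 < p.1}.indicator
      fun p => ENNReal.ofReal (Real.exp (-(c * p.2)))) (y, t) ≤
      ENNReal.ofReal (max 1 (1 / c)) * ENNReal.ofReal (min y 1) := by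
    intro y
    refine le_trans (le_of_eq ?_) (lintegral_exp_Ico_le hc)
    rw [← lintegral_indicator measurableSet_Ico]
    rfl
  refine (lintegral_mono h1).trans_lt ?_
  rw [lintegral_const_mul _ (by fun_prop)]
  exact ENNReal.mul_lt_top ENNReal.ofReal_lt_top hμ.integrable_min

lemma integral_exp_Ico {z : ℂ} (hz : z ≠ 0) {y : ℝ} (hy : 0 ≤ y) :
    ∫ t in Ico 0 y, Complex.exp (-(z * t)) = z⁻¹ * (1 - Complex.exp (-(z * y))) := by
  rw [integral_Ico_eq_integral_Ioc, ← intervalIntegral.integral_of_le hy]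
  have h := integral_exp_mul_complex (a := 0) (b := y) (c := -z) (neg_ne_zero.2 hz)
  simp only [neg_mul] at h
  rw [h]
  simp only [Complex.ofReal_zero, mul_zero, neg_zero, Complex.exp_zero]
  field_simp
  ring

lemma laplace_levyTail (hμ : IsLevyMeasure μ) {z : ℂ} (hz : 0 < z.re) :
    laplace (densityMeasure (levyTail μ)) z =
      z⁻¹ * ∫ y, (1 - Complex.exp (-(z * (y : ℂ)))) ∂μ := by
  have := hμ.sigmaFinite
  have hz0 : z ≠ 0 := by rintro rfl; simp at hz
  have hi := hμ.laplaceFinite_levyTail.integrable hz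
  have hmeas : ∀ ν : Measure ℝ,
      AEStronglyMeasurable (fun y : ℝ => Complex.exp (-(z * y))) ν :=
    fun ν => Continuous.aestronglyMeasurable (by fun_prop)
  rw [densityMeasure_levyTail, integrable_map_measure (hmeas _) measurable_snd.aemeasurable,
    ← IntegrableOn, ← integrable_indicator_iff measurableSet_below] at hi
  rw [laplace, densityMeasure_levyTail, integral_map measurable_snd.aemeasurable (hmeas _),
    ← integral_indicator measurableSet_below]
  refine (integral_prod _ hi).trans ?_
  rw [← integral_const_mul]
  refine integral_congr_ae ?_
  filter_upwards [hμ.ae_pos] with y hy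
  rw [← integral_exp_Ico hz0 hy.le, ← integral_indicator measurableSet_Ico]
  rfl

lemma bernsteinFn_eq (hμ : IsLevyMeasure μ) (q b : ℝ) {z : ℂ} (hz : 0 < z.re) :
    laplace (densityMeasure (levyTail μ)) z = (bernsteinFn q b μ z - q - b * z) / z := by
  rw [hμ.laplace_levyTail hz, bernsteinFn]
  ring

end IsLevyMeasure

/-! ### The law of the killed subordinator -/

/-- A monotone additive function on `[0, ∞)` is linear. -/
lemma eq_mul_of_additive_of_monotone {ψ : ℝ≥0 → ℝ} (hadd : ∀ x y, ψ (x + y) = ψ x + ψ y)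
    (hmono : Monotone ψ) (x : ℝ≥0) : ψ x = x * ψ 1 := by
  have h0 : ψ 0 = 0 := by simpa using hadd 0 0
  have hn : ∀ (n : ℕ) (y : ℝ≥0), ψ (n * y) = n * ψ y := by
    intro n y
    induction n with
    | zero => simp [h0]
    | succ n ih => push_cast; rw [add_mul, hadd, ih]; ring_nf
  have h1 : ∀ k : ℕ, ψ k = k * ψ 1 := fun k => by simpa using hn k 1
  have hp : 0 ≤ ψ 1 := by rw [← h0]; exact hmono zero_le_one
  -- Both `ψ (n x)` and `n x ψ 1` lie between `k ψ 1` and `(k + 1) ψ 1`, where `k` is the integer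
  -- part of `n x`. A bound uniform in `n` forces the difference to vanish.
  have key : ∀ n : ℕ, |n * (ψ x - x * ψ 1)| ≤ ψ 1 := by
    intro n
    set k := ⌊(n : ℝ≥0) * x⌋₊
    have ha : (k : ℝ≥0) ≤ n * x := Nat.floor_le (zero_le)
    have hb : (n : ℝ≥0) * x ≤ (k + 1 : ℕ) := by
      push_cast; exact (Nat.lt_floor_add_one _).le
    have h2 := hmono ha
    have h3 := hmono hb
    rw [h1, hn] at h2
    rw [h1, hn] at h3
    have ha' : (k : ℝ) ≤ n * x := by exact_mod_cast ha
    have hb' : (n : ℝ) * x ≤ k + 1 := by exact_mod_cast hb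
    have h4 := mul_le_mul_of_nonneg_right ha' hp
    have h5 := mul_le_mul_of_nonneg_right hb' hp
    push_cast at h3
    rw [abs_le]
    constructor <;> linarith
  by_contra hne
  have hpos : 0 < |ψ x - x * ψ 1| := abs_pos.2 (sub_ne_zero.2 hne)
  obtain ⟨n, hn'⟩ := exists_nat_gt (ψ 1 / |ψ x - x * ψ 1|)
  rw [div_lt_iff₀ hpos] at hn'
  have := key n
  rw [abs_mul, Nat.abs_cast] at this
  linarith

variable {Ω : Type*} [MeasurableSpace Ω] {P : Measure Ω}
  {S : ℝ≥0 → Ω → ℝ}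

namespace IsSubordinator

lemma ae_nonneg (hS : IsSubordinator P S) (x : ℝ≥0) : ∀ᵐ ω ∂P, 0 ≤ S x ω := by
  filter_upwards [hS.zero, hS.monotone] with ω h0 hm
  rw [← h0]
  exact hm zero_le

lemma integrable_exp [IsProbabilityMeasure P] (hS : IsSubordinator P S) (x : ℝ≥0) {s : ℝ} (hs : s ≤ 0) :
    Integrable (fun ω => Real.exp (s * S x ω)) P := by
  have hm := hS.measurable x
  refine (integrable_const (1 : ℝ)).mono' (Measurable.aestronglyMeasurable (by fun_prop)) ?_
  filter_upwards [hS.ae_nonneg x] with ω hω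
  rw [Real.norm_of_nonneg (Real.exp_pos _).le, Real.exp_le_one_iff]
  exact mul_nonpos_of_nonpos_of_nonneg hs hω

lemma mgf_add (hS : IsSubordinator P S) (x h : ℝ≥0) (s : ℝ) :
    mgf (S (x + h)) P s = mgf (S x) P s * mgf (S h) P s := by
  have hmx := hS.measurable x
  have hmh := hS.measurable (x + h)
  have hi : IndepFun (S x) (S (x + h) - S x) P :=
    hS.indepIncrements.indepFun_eval_sub (r := 0) zero_le le_self_add hS.zero
  have h1 : S (x + h) = S x + (S (x + h) - S x) := by simp
  have h2 : mgf (S (x + h) - S x) P s = mgf (S h) P s :=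
    mgf_congr_identDistrib (hS.stationary x h) ▸ rfl
  conv_lhs => rw [h1]
  rw [hi.mgf_add (Measurable.aestronglyMeasurable (by fun_prop))
    (Measurable.aestronglyMeasurable (by fun_prop)), h2]

/-- For real `s ≤ 0`, `-log E[exp (s S(x))]` is additive in `x` by the stationary independent
increments and nondecreasing because the paths are; monotonicity replaces continuity in Cauchy's
equation. -/
lemma mgf_eq_exp [IsProbabilityMeasure P] (hS : IsSubordinator P S) {s : ℝ} (hs : s ≤ 0) (x : ℝ≥0) :
    mgf (S x) P s = Real.exp (x * Real.log (mgf (S 1) P s)) := by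
  have hpos : ∀ y, 0 < mgf (S y) P s := fun y => mgf_pos (hS.integrable_exp y hs)
  have h := eq_mul_of_additive_of_monotone (ψ := fun y => -Real.log (mgf (S y) P s)) ?_ ?_ x
  · rw [← Real.exp_log (hpos x)]
    congr 1
    linarith
  · intro y z
    rw [hS.mgf_add, Real.log_mul (hpos y).ne' (hpos z).ne']
    ring
  · intro y z hyz
    refine neg_le_neg (Real.log_le_log (hpos z) ?_)
    refine integral_mono_ae (hS.integrable_exp z hs) (hS.integrable_exp y hs) ?_
    filter_upwards [hS.monotone] with ω hm
    exact Real.exp_le_exp.2 (mul_le_mul_of_nonpos_left (hm hyz) hs)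

end IsSubordinator

/-- The law of a subordinator killed at rate `q`, at time `x`, restricted to `[0, ∞)`. -/
def killedLaw (P : Measure Ω) (S : ℝ≥0 → Ω → ℝ) (q : ℝ) (x : ℝ≥0) : Measure ℝ :=
  ENNReal.ofReal (Real.exp (-(q * x))) • P.map (S x)

instance [IsProbabilityMeasure P] (q : ℝ) (x : ℝ≥0) : IsFiniteMeasure (killedLaw P S q x) := by
  unfold killedLaw
  exact Measure.smul_finite _ ENNReal.ofReal_ne_top

/-- By independence, the factor `exp (-q x)` is the same as restriction to the event of survival
past `x`. -/
lemma killedLaw_eq {q : ℝ} {e : Ω → ℝ≥0∞} (hS : IsSubordinator P S)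
    (hexp : ∀ x : ℝ≥0, P {ω | (x : ℝ≥0∞) < e ω} = ENNReal.ofReal (Real.exp (-(q * x))))
    (hind : IndepFun (fun ω (x : ℝ≥0) => S x ω) e P) (x : ℝ≥0) :
    killedLaw P S q x = (P.restrict {ω | (x : ℝ≥0∞) < e ω}).map (S x) := by
  have hi : IndepFun (S x) e P := hind.comp (measurable_pi_apply x) measurable_id
  have hm := hS.measurable x
  ext A hA
  rw [killedLaw, Measure.smul_apply, Measure.map_apply hm hA, Measure.map_apply hm hA,
    Measure.restrict_apply (hm hA), smul_eq_mul, ← hexp]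
  have := hi.measure_inter_preimage_eq_mul A (Ioi (x : ℝ≥0∞)) hA measurableSet_Ioi
  rw [mul_comm]
  exact this.symm

lemma laplaceFinite_killedLaw [IsProbabilityMeasure P] (hS : IsSubordinator P S) (q : ℝ) (x : ℝ≥0) :
    LaplaceFinite (killedLaw P S q x) := by
  have hm := hS.measurable x
  have h0 : ∀ᵐ y ∂(P.map (S x)), 0 ≤ y :=
    (ae_map_iff hm.aemeasurable measurableSet_Ici).2 (hS.ae_nonneg x)
  constructor
  · have : (P.map (S x)) (Iio 0) = 0 := by
      rw [ae_iff] at h0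
      simpa [Iio] using h0
    rw [killedLaw, Measure.smul_apply, this, smul_zero]
  · intro c hc
    have h1 : ∀ᵐ y ∂(killedLaw P S q x), ENNReal.ofReal (Real.exp (-(c * y))) ≤ 1 := by
      refine Measure.ae_smul_measure ?_ _
      filter_upwards [h0] with y hy
      rw [ENNReal.ofReal_le_one, Real.exp_le_one_iff]
      have := mul_nonneg hc.le hy
      linarith
    refine (lintegral_mono_ae h1).trans_lt ?_
    rw [lintegral_one]
    exact measure_lt_top _ _

lemma laplace_killedLaw (hS : IsSubordinator P S) (q : ℝ) (x : ℝ≥0) (z : ℂ) :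
    laplace (killedLaw P S q x) z = Real.exp (-(q * x)) * complexMGF (S x) P (-z) := by
  rw [laplace, killedLaw, integral_smul_measure, ENNReal.toReal_ofReal (Real.exp_pos _).le,
    Complex.real_smul, integral_map (hS.measurable x).aemeasurable
    (Continuous.aestronglyMeasurable (by fun_prop)), complexMGF]
  simp only [neg_mul]

lemma bernsteinFn_ofReal (q b : ℝ) (μ : Measure ℝ) (s : ℝ) :
    bernsteinFn q b μ s =
      ((q + b * s + ∫ y, (1 - Real.exp (-(s * y))) ∂μ : ℝ) : ℂ) := by
  have h := integral_ofReal (𝕜 := ℂ) (μ := μ) (f := fun y => 1 - Real.exp (-(s * y)))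
  rw [bernsteinFn, Complex.ofReal_add,
    show ((∫ y, (1 - Real.exp (-(s * y))) ∂μ : ℝ) : ℂ) = _ from h.symm]
  simp

/-- At real `s` both exponents are real, so they can be identified at time `1` without a `2 π i`
ambiguity and then scaled by `x`. -/
lemma laplace_killedLaw_ofReal [IsProbabilityMeasure P] (hS : IsSubordinator P S) {q b : ℝ} {μ : Measure ℝ} {s : ℝ}
    (hs : 0 ≤ s) (h1 : laplace (killedLaw P S q 1) s = Complex.exp (-bernsteinFn q b μ s))
    (x : ℝ≥0) :
    laplace (killedLaw P S q x) s = Complex.exp (-(x * bernsteinFn q b μ s)) := by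
  have e : ∀ y : ℝ≥0, laplace (killedLaw P S q y) s =
      ((Real.exp (y * (-q + Real.log (mgf (S 1) P (-s)))) : ℝ) : ℂ) := by
    intro y
    rw [laplace_killedLaw hS, ← Complex.ofReal_neg, complexMGF_ofReal,
      hS.mgf_eq_exp (neg_nonpos.2 hs), ← Complex.ofReal_mul, ← Real.exp_add]
    ring_nf
  rw [e, bernsteinFn_ofReal] at h1
  rw [e, bernsteinFn_ofReal]
  set B := q + b * s + ∫ y, (1 - Real.exp (-(s * y))) ∂μ
  have h2 : Real.exp (((1 : ℝ≥0) : ℝ) * (-q + Real.log (mgf (S 1) P (-s)))) = Real.exp (-B) := by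
    exact_mod_cast h1
  rw [Real.exp_eq_exp, NNReal.coe_one, one_mul] at h2
  rw [h2]
  push_cast
  ring_nf

/-- The Laplace transform of a killed subordinator, from its value at time `1` by the semigroup
property on the positive reals and analytic continuation. -/
lemma laplace_killedLaw_eq [IsProbabilityMeasure P] (hS : IsSubordinator P S) {q b : ℝ} {μ : Measure ℝ}
    (h1 : ∀ s : ℝ, 0 ≤ s → laplace (killedLaw P S q 1) s = Complex.exp (-bernsteinFn q b μ s))
    (hd : DifferentiableOn ℂ (bernsteinFn q b μ) {z | 0 < z.re}) (x : ℝ≥0) {z : ℂ}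
    (hz : 0 < z.re) :
    laplace (killedLaw P S q x) z = Complex.exp (-(x * bernsteinFn q b μ z)) := by
  have hopen : IsOpen {z : ℂ | 0 < z.re} := isOpen_lt continuous_const Complex.continuous_re
  have hsub : Iio (0 : ℝ) ⊆ interior (integrableExpSet (S x) P) :=
    interior_maximal (fun s hs => hS.integrable_exp x (le_of_lt hs)) isOpen_Iio
  have d1 : DifferentiableOn ℂ (laplace (killedLaw P S q x)) {z | 0 < z.re} := by
    have : DifferentiableOn ℂ (fun z : ℂ => Real.exp (-(q * x)) * complexMGF (S x) P (-z))
        {z | 0 < z.re} := by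
      refine DifferentiableOn.const_mul (differentiableOn_complexMGF.comp
        differentiableOn_id.neg fun z hz => hsub ?_) _
      have hz : 0 < z.re := hz
      simpa using hz
    exact this.congr fun z _ => laplace_killedLaw hS q x z
  have d2 : DifferentiableOn ℂ (fun z => Complex.exp (-(x * bernsteinFn q b μ z)))
      {z | 0 < z.re} := (hd.const_mul _).neg.cexp
  refine (d1.analyticOnNhd hopen).eqOn_of_preconnected_of_frequently_eq (d2.analyticOnNhd hopen)
    ((convex_halfSpace_re_gt 0).isPreconnected) (z₀ := 1) (by simp) ?_ hz
  have ht : Tendsto (fun s : ℝ => (s : ℂ)) (𝓝[≠] 1) (𝓝[≠] 1) := by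
    refine tendsto_nhdsWithin_iff.2 ⟨?_, ?_⟩
    · have : ContinuousAt (fun s : ℝ => (s : ℂ)) 1 := Complex.continuous_ofReal.continuousAt
      simpa using this.tendsto.mono_left nhdsWithin_le_nhds
    · filter_upwards [self_mem_nhdsWithin] with s hs
      have : s ≠ 1 := hs
      simpa using this
  refine ht.frequently (Eventually.frequently ?_)
  filter_upwards [nhdsWithin_le_nhds (Ioi_mem_nhds (zero_lt_one' ℝ))] with s hs
  exact laplace_killedLaw_ofReal hS (le_of_lt hs) (h1 s (le_of_lt hs)) x

section Killed

variable {σ : ℝ≥0 → Ω → ℝ≥0∞} {q : ℝ} {e : Ω → ℝ≥0∞}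

lemma laplace_killedLaw_one (hS : IsSubordinator P S) (he : Measurable e)
    (hexp : ∀ x : ℝ≥0, P {ω | (x : ℝ≥0∞) < e ω} = ENNReal.ofReal (Real.exp (-(q * x))))
    (hind : IndepFun (fun ω (x : ℝ≥0) => S x ω) e P)
    (hσ : ∀ (x : ℝ≥0) (ω : Ω),
      ((x : ℝ≥0∞) < e ω → σ x ω = ENNReal.ofReal (S x ω)) ∧ (e ω ≤ (x : ℝ≥0∞) → σ x ω = ∞))
    {Φ : ℂ → ℂ} (hΦ : HasLaplaceExponent P σ Φ) {z : ℂ} (hz : 0 ≤ z.re) :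
    laplace (killedLaw P S q 1) z = Complex.exp (-Φ z) := by
  have hset : {ω | σ 1 ω ≠ ∞} = {ω | ((1 : ℝ≥0) : ℝ≥0∞) < e ω} := by
    ext ω
    simp only [mem_ofPred_eq]
    constructor
    · intro h
      by_contra! h2
      exact h ((hσ 1 ω).2 h2)
    · intro h
      rw [(hσ 1 ω).1 h]
      exact ENNReal.ofReal_ne_top
  have hms : MeasurableSet {ω | ((1 : ℝ≥0) : ℝ≥0∞) < e ω} := measurableSet_lt measurable_const he
  rw [← hΦ z hz, hset, laplace, killedLaw_eq hS hexp hind,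
    integral_map (hS.measurable 1).aemeasurable (Continuous.aestronglyMeasurable (by fun_prop))]
  refine integral_congr_ae ((ae_restrict_iff' hms).2 ?_)
  filter_upwards [hS.ae_nonneg 1] with ω hω hlt
  rw [(hσ 1 ω).1 hlt, ENNReal.toReal_ofReal hω]

lemma densityJump_eq (hS : IsSubordinator P S) (he : Measurable e)
    (hexp : ∀ x : ℝ≥0, P {ω | (x : ℝ≥0∞) < e ω} = ENNReal.ofReal (Real.exp (-(q * x))))
    (hind : IndepFun (fun ω (x : ℝ≥0) => S x ω) e P)
    (hσ : ∀ (x : ℝ≥0) (ω : Ω),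
      ((x : ℝ≥0∞) < e ω → σ x ω = ENNReal.ofReal (S x ω)) ∧ (e ω ≤ (x : ℝ≥0∞) → σ x ω = ∞))
    {b : ℝ} (μ : Measure ℝ) {x t : ℝ} (hxt : (x, t) ∈ region b) :
    densityJump P σ b μ x t = convMeasure (levyTail μ) (killedLaw P S q x.toNNReal) t := by
  have ht : 0 < t := hxt.1
  set y := x.toNNReal
  have hms : MeasurableSet {ω | (y : ℝ≥0∞) < e ω} := measurableSet_lt measurable_const he
  have hSm := hS.measurable y
  have htail := IsLevyMeasure.measurable_levyTail μ
  have hσm : Measurable (σ y) := by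
    classical
    have : σ y = {ω | (y : ℝ≥0∞) < e ω}.piecewise (fun ω => ENNReal.ofReal (S y ω)) fun _ => ∞ := by
      funext ω
      by_cases h : ω ∈ {ω | (y : ℝ≥0∞) < e ω}
      · rw [piecewise_eq_of_mem _ _ _ h, (hσ y ω).1 h]
      · rw [piecewise_eq_of_notMem _ _ _ h, (hσ y ω).2 (not_lt.1 h)]
    rw [this]
    exact Measurable.piecewise hms (by fun_prop) measurable_const
  -- Killed paths sit at `∞`, outside `[0, t]`, so only survivors contribute.
  have hset : σ y ⁻¹' Iic (ENNReal.ofReal t) = S y ⁻¹' Iic t ∩ {ω | (y : ℝ≥0∞) < e ω} := by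
    ext ω
    simp only [mem_preimage, mem_Iic, mem_inter_iff, mem_ofPred_eq]
    by_cases h : (y : ℝ≥0∞) < e ω
    · rw [(hσ y ω).1 h, ENNReal.ofReal_le_ofReal_iff ht.le]
      simp [h]
    · rw [(hσ y ω).2 (not_lt.1 h)]
      simp [h]
  rw [densityJump, if_pos hxt, setLIntegral_map measurableSet_Iic (by fun_prop) hσm, hset,
    convMeasure, killedLaw_eq hS hexp hind,
    setLIntegral_map measurableSet_Icc (by fun_prop) hSm,
    Measure.restrict_restrict (hSm measurableSet_Icc)]
  have hae : (S y ⁻¹' Iic t ∩ {ω | (y : ℝ≥0∞) < e ω} : Set Ω) =ᵐ[P]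
      (S y ⁻¹' Icc 0 t ∩ {ω | (y : ℝ≥0∞) < e ω} : Set Ω) := by
    refine Filter.eventuallyEq_set.2 ?_
    filter_upwards [hS.ae_nonneg y] with ω hω
    simp [hω]
  rw [Measure.restrict_congr_set hae]
  refine setLIntegral_congr_fun ((hSm measurableSet_Icc).inter hms) fun ω hω => ?_
  rw [(hσ y ω).1 hω.2, ENNReal.toReal_ofReal hω.1.1]

end Killed

/-! ### The symbol of the tail -/

/-- The Laplace transform of the tail of the Lévy measure, extended to the wedge. -/
def tailSymbol (F : ℂ → ℂ) (q b : ℝ) (z : ℂ) : ℂ := (F z - q - b * z) / z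

lemma ne_zero_of_mem_wedge {κ : ℝ} {z : ℂ} (hz : z ∈ wedge κ) : z ≠ 0 := by
  rintro rfl
  simp [wedge] at hz

lemma mem_wedge_of_re_pos {κ : ℝ} (hκ : 0 ≤ κ) {z : ℂ} (hz : 0 < z.re) : z ∈ wedge κ :=
  add_pos_of_pos_of_nonneg hz (mul_nonneg hκ (abs_nonneg _))

namespace IsWedgeExtension

variable {κ b c : ℝ} {F : ℂ → ℂ}

lemma differentiableOn_tailSymbol (hF : IsWedgeExtension κ b F) (q : ℝ) :
    DifferentiableOn ℂ (tailSymbol F q b) (wedge κ) :=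
  ((hF.diff.sub_const _).sub (by fun_prop)).div differentiableOn_id
    fun _ hz => ne_zero_of_mem_wedge hz

/-- The numerator grows at most linearly and `|z| ≥ c / 2` keeps the denominator away from `0`. -/
lemma tailSymbol_bound (hF : IsWedgeExtension κ b F) (q : ℝ) (hc : 0 < c) :
    ∃ D, ∀ z : ℂ, c ≤ z.re + κ * |z.im| → ‖tailSymbol F q b z‖ ≤ D := by
  obtain ⟨C, hC0, hC⟩ := hF.lin_bound hc zero_lt_one
  refine ⟨(C + |q|) * (2 / c) + 1, fun z hz => ?_⟩
  have h1 := hF.half_le_norm hz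
  have h2 : 0 < ‖z‖ := lt_of_lt_of_le (by positivity) h1
  rw [tailSymbol, norm_div, div_le_iff₀ h2]
  have h3 : ‖F z - q - b * z‖ ≤ ‖F z - b * z‖ + |q| := by
    rw [show F z - q - b * z = (F z - b * z) - q by ring]
    refine (norm_sub_le _ _).trans (by simp)
  have h4 : 1 ≤ 2 / c * ‖z‖ := by
    rw [div_mul_eq_mul_div, le_div_iff₀ hc]; linarith
  have h5 : (C + |q|) * 1 ≤ (C + |q|) * (2 / c * ‖z‖) :=
    mul_le_mul_of_nonneg_left h4 (by positivity)
  linarith [hC z hz]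

lemma differentiableOn_inv : DifferentiableOn ℂ (fun z : ℂ => z⁻¹) (wedge κ) :=
  differentiableOn_id.inv fun _ hz => ne_zero_of_mem_wedge hz

lemma norm_inv_le (hF : IsWedgeExtension κ b F) (hc : 0 < c) (z : ℂ)
    (hz : c ≤ z.re + κ * |z.im|) : ‖z⁻¹‖ ≤ 2 / c := by
  have h1 := hF.half_le_norm hz
  rw [norm_inv, ← inv_div]
  exact inv_anti₀ (by positivity) h1

/-- The inverse Laplace transform at a fixed `x`, as a real function of `t`. -/
lemma contDiffOn_inverse_right (hF : IsWedgeExtension κ b F) (hc : 0 < c) {Q : ℂ → ℂ}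
    (hQ : DifferentiableOn ℂ Q (wedge κ)) {D : ℝ}
    (hD : ∀ z : ℂ, c ≤ z.re + κ * |z.im| → ‖Q z‖ ≤ D) (x : ℝ) :
    ContDiffOn ℝ (⊤ : ℕ∞) (fun t => (hF.inverse c Q (x, t)).re) (Ioi (b * x)) := by
  have h1 : ContDiffOn ℝ (⊤ : ℕ∞) (fun t : ℝ => hF.inverse c Q (x, t)) (Ioi (b * x)) :=
    (hF.contDiffOn_inverse hc hQ hD).comp (g := hF.inverse c Q) (f := fun t : ℝ => (x, t))
      (by fun_prop) fun t ht => ht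
  exact Complex.reCLM.contDiff.comp_contDiffOn h1

end IsWedgeExtension

/-! ### Smoothness of the tail and of its convolution powers -/

section Tail

variable {κ q b : ℝ} {F : ℂ → ℂ} {μ : Measure ℝ}

lemma laplace_levyTail_eq_tailSymbol (hμ : IsLevyMeasure μ)
    (hFΦ : ∀ z : ℂ, 0 ≤ z.re → F z = bernsteinFn q b μ z) {z : ℂ} (hz : 0 < z.re) :
    laplace (densityMeasure (levyTail μ)) z = tailSymbol F q b z := by
  rw [hμ.bernsteinFn_eq q b hz, tailSymbol, hFΦ z hz.le]

lemma continuousAt_of_toReal {g : ℝ → ℝ≥0∞} {t : ℝ} (hf : ∀ᶠ s in 𝓝 t, g s ≠ ∞)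
    (h : ContinuousAt (fun s => (g s).toReal) t) : ContinuousAt g t := by
  have h2 : ContinuousAt (fun s => ENNReal.ofReal (g s).toReal) t :=
    ENNReal.continuous_ofReal.continuousAt.comp h
  exact h2.congr (hf.mono fun s hs => ENNReal.ofReal_toReal hs)

lemma continuousAt_toReal {g : ℝ → ℝ≥0∞} {t : ℝ} (hf : g t ≠ ∞) (h : ContinuousAt g t) :
    ContinuousAt (fun s => (g s).toReal) t :=
  (ENNReal.tendsto_toReal hf).comp h

/-- This is inversion with `x = 0`, valid first where the monotone tail is continuous. -/
lemma levyTail_toReal_eq (hμ : IsLevyMeasure μ) (hF : IsWedgeExtension κ b F)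
    (hFΦ : ∀ z : ℂ, 0 ≤ z.re → F z = bernsteinFn q b μ z) {t : ℝ} (ht : 0 < t) :
    (levyTail μ t).toReal = (hF.inverse 1 (tailSymbol F q b) (0, t)).re := by
  obtain ⟨D, hD⟩ := hF.tailSymbol_bound q one_pos
  have hQ := hF.differentiableOn_tailSymbol q
  refine measure_Ioi_toReal_eq (a := 0) (h := fun t =>
    (hF.inverse 1 (tailSymbol F q b) (0, t)).re) (fun t ht => hμ.levyTail_ne_top ht) ?_ ?_ ht
  · have := (hF.contDiffOn_inverse_right one_pos hQ hD 0).continuousOn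
    rwa [mul_zero] at this
  · intro t ht hcont
    have := hF.toReal_eq_inverse one_pos hQ hD (x := 0) (t := t) (by simpa using ht)
      (IsLevyMeasure.measurable_levyTail μ) hμ.laplaceFinite_levyTail (fun z hz => by
        rw [laplace_levyTail_eq_tailSymbol hμ hFΦ hz]; simp) ht hcont
    rw [← this]
    rfl

lemma continuousAt_levyTail (hμ : IsLevyMeasure μ) (hF : IsWedgeExtension κ b F)
    (hFΦ : ∀ z : ℂ, 0 ≤ z.re → F z = bernsteinFn q b μ z) {t : ℝ} (ht : 0 < t) :
    ContinuousAt (levyTail μ) t := by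
  obtain ⟨D, hD⟩ := hF.tailSymbol_bound q one_pos
  have h1 := (hF.contDiffOn_inverse_right one_pos
    (hF.differentiableOn_tailSymbol q) hD 0).continuousOn
  rw [mul_zero] at h1
  have hmem : Ioi (0 : ℝ) ∈ 𝓝 t := Ioi_mem_nhds ht
  refine continuousAt_of_toReal ?_ ((h1.continuousAt hmem).congr ?_)
  · filter_upwards [hmem] with s hs using hμ.levyTail_ne_top hs
  · filter_upwards [hmem] with s hs using (levyTail_toReal_eq hμ hF hFΦ hs).symm

/-- Convolution of the tail with a measure that has a continuous density on `(a, ∞)`. -/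
lemma continuousAt_convMeasure_levyTail (hμ : IsLevyMeasure μ) (hF : IsWedgeExtension κ b F)
    (hFΦ : ∀ z : ℂ, 0 ≤ z.re → F z = bernsteinFn q b μ z) {ν : Measure ℝ} (hν : LaplaceFinite ν)
    {k : ℝ → ℝ≥0∞} (hk : Measurable k) {a : ℝ} (ha : 0 ≤ a) (hkc : ContinuousOn k (Ioi a))
    (hkf : ∀ y, a < y → k y ≠ ∞)
    (hνk : ∀ c, a < c → ν.restrict (Ioi c) = (volume.restrict (Ioi c)).withDensity k)
    {t : ℝ} (ht : a < t) :
    convMeasure (levyTail μ) ν t ≠ ∞ ∧ ContinuousAt (convMeasure (levyTail μ) ν) t :=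
  continuousAt_convMeasure (IsLevyMeasure.measurable_levyTail μ) (IsLevyMeasure.antitone_levyTail μ)
    (fun _ hs => continuousAt_levyTail hμ hF hFΦ hs) (fun _ hs => hμ.levyTail_ne_top hs)
    hμ.laplaceFinite_levyTail hν hk ha hkc hkf hνk ht

/-- The four properties are proved together: continuity of one power makes it a continuous density
on `(0, ∞)`, which is the hypothesis under which convolution with the tail is again finite and
continuous. The index `n + 1` avoids the placeholder power `0`. -/
lemma convPow_levyTail (hμ : IsLevyMeasure μ) (hF : IsWedgeExtension κ b F)
    (hFΦ : ∀ z : ℂ, 0 ≤ z.re → F z = bernsteinFn q b μ z) (n : ℕ) :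
    Measurable (convPow (levyTail μ) (n + 1)) ∧
    LaplaceFinite (densityMeasure (convPow (levyTail μ) (n + 1))) ∧
    (∀ z : ℂ, 0 < z.re → laplace (densityMeasure (convPow (levyTail μ) (n + 1))) z =
      tailSymbol F q b z ^ (n + 1)) ∧
    ∀ t, 0 < t → convPow (levyTail μ) (n + 1) t ≠ ∞ ∧
      ContinuousAt (convPow (levyTail μ) (n + 1)) t := by
  have hm := IsLevyMeasure.measurable_levyTail μ
  induction n with
  | zero =>
    refine ⟨hm, hμ.laplaceFinite_levyTail, fun z hz => ?_, fun t ht =>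
      ⟨hμ.levyTail_ne_top ht, continuousAt_levyTail hμ hF hFΦ ht⟩⟩
    rw [zero_add, pow_one]
    exact laplace_levyTail_eq_tailSymbol hμ hFΦ hz
  | succ n ih =>
    obtain ⟨h1, h2, h3, h4⟩ := ih
    set g := convPow (levyTail μ) (n + 1)
    have e : convPow (levyTail μ) (n + 1 + 1) = convMeasure (levyTail μ) (densityMeasure g) :=
      funext fun t => conv_eq_convMeasure hm h1 t
    rw [e]
    refine ⟨measurable_convMeasure hm _, laplaceFinite_convMeasure hm hμ.laplaceFinite_levyTail h2,
      fun z hz => ?_, fun t ht => ?_⟩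
    · rw [laplace_convMeasure hm h2, h3 z hz, laplace_levyTail_eq_tailSymbol hμ hFΦ hz, pow_succ' _ (n + 1)]
    · refine continuousAt_convMeasure_levyTail hμ hF hFΦ h2 h1 le_rfl
        (fun y hy => (h4 y hy).2.continuousWithinAt) (fun y hy => (h4 y hy).1) (fun c hc => ?_) ht
      rw [densityMeasure, restrict_withDensity measurableSet_Ioi,
        Measure.restrict_restrict measurableSet_Ioi,
        inter_eq_left.2 (Ioi_subset_Ici_self.trans (Ici_subset_Ici.2 hc.le))]

lemma contDiffOn_convPow_levyTail (hμ : IsLevyMeasure μ) (hF : IsWedgeExtension κ b F)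
    (hFΦ : ∀ z : ℂ, 0 ≤ z.re → F z = bernsteinFn q b μ z) (n : ℕ) :
    ContDiffOn ℝ (⊤ : ℕ∞) (fun t => (convPow (levyTail μ) (n + 1) t).toReal) (Ioi (0 : ℝ)) := by
  obtain ⟨h1, h2, h3, h4⟩ := convPow_levyTail hμ hF hFΦ n
  obtain ⟨D, hD⟩ := hF.tailSymbol_bound q one_pos
  have hQ := (hF.differentiableOn_tailSymbol q).pow (n + 1)
  have hD' : ∀ z : ℂ, 1 ≤ z.re + κ * |z.im| → ‖(tailSymbol F q b ^ (n + 1)) z‖ ≤ D ^ (n + 1) := by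
    intro z hz
    rw [Pi.pow_apply, norm_pow]
    exact pow_le_pow_left₀ (norm_nonneg _) (hD z hz) _
  have h5 := hF.contDiffOn_inverse_right one_pos hQ hD' 0
  rw [mul_zero] at h5
  refine h5.congr fun t ht => ?_
  have ht : 0 < t := ht
  have := hF.toReal_eq_inverse one_pos hQ hD' (x := 0) (t := t) (by simpa using ht) h1 h2
    (fun z hz => by rw [h3 z hz]; simp) ht (continuousAt_toReal (h4 t ht).1 (h4 t ht).2)
  rw [← this]
  rfl

end Tail

/-! ### The density of the law and the function `f_Φ` -/

section Law

variable {κ q b : ℝ} {F : ℂ → ℂ} {μ : Measure ℝ}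

lemma laplaceFinite_one : LaplaceFinite (densityMeasure fun _ => 1) := by
  refine ⟨densityMeasure_Iio _, fun c hc => ?_⟩
  have h2 : IntegrableOn (fun t : ℝ => Real.exp (-(c * t))) (Ioi 0) := by
    simpa [neg_mul] using exp_neg_integrableOn_Ioi 0 hc
  rw [lintegral_densityMeasure measurable_const (by fun_prop)]
  simp only [one_mul]
  rw [Measure.restrict_congr_set Ioi_ae_eq_Ici.symm]
  exact h2.lintegral_lt_top

lemma laplace_one {z : ℂ} (hz : 0 < z.re) : laplace (densityMeasure fun _ => 1) z = z⁻¹ := by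
  have h1 : densityMeasure (fun _ => 1) = volume.restrict (Ici 0) := by
    rw [densityMeasure]; exact withDensity_one
  have h := integral_exp_mul_complex_Ioi (a := -z) (by simpa using hz) 0
  rw [laplace, h1, integral_Ici_eq_integral_Ioi]
  simpa [neg_mul, neg_div_neg_eq] using h

/-- A finite measure on `[0, ∞)` with Laplace transform `exp (-x F)` has a continuous density
on `(b x, ∞)`. -/
lemma exists_density (hF : IsWedgeExtension κ b F) {x : ℝ} (hbx : 0 ≤ b * x) {ν : Measure ℝ}
    [IsFiniteMeasure ν] (hν : LaplaceFinite ν)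
    (hL : ∀ z : ℂ, 0 < z.re → laplace ν z = Complex.exp (-(x * F z))) :
    ∃ k : ℝ → ℝ, Measurable k ∧ ContinuousOn k (Ioi (b * x)) ∧
      ∀ c, b * x < c → ν.restrict (Ioi c) =
        (volume.restrict (Ioi c)).withDensity fun t => ENNReal.ofReal (k t) := by
  have hQ : DifferentiableOn ℂ (fun z : ℂ => z⁻¹) (wedge κ) :=
    IsWedgeExtension.differentiableOn_inv
  have hD := hF.norm_inv_le one_pos
  -- Division by `z` passes to the distribution function, whose monotonicity provides the points of
  -- continuity that inversion needs. It turns out to be smooth beyond `b x`, and its derivative is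
  -- the density.
  set h : ℝ → ℝ := fun t => (hF.inverse 1 (fun z => z⁻¹) (x, t)).re
  have hsm : ContDiffOn ℝ (⊤ : ℕ∞) h (Ioi (b * x)) := hF.contDiffOn_inverse_right one_pos hQ hD x
  have hdist : ∀ t, convMeasure (fun _ => 1) ν t = ν univ - ν (Ioi t) := by
    intro t
    rw [convMeasure, setLIntegral_one, ← measure_compl measurableSet_Ioi (measure_ne_top _ _),
      compl_Ioi]
    refine le_antisymm (measure_mono fun y hy => hy.2) ?_
    calc ν (Iic t) ≤ ν (Iio 0 ∪ Icc 0 t) := measure_mono fun y hy => by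
          rcases lt_or_ge y 0 with h | h
          · exact Or.inl h
          · exact Or.inr ⟨h, hy⟩
      _ ≤ ν (Iio 0) + ν (Icc 0 t) := measure_union_le _ _
      _ = ν (Icc 0 t) := by rw [hν.carrier, zero_add]
  have hreal : ∀ t, (convMeasure (fun _ => 1) ν t).toReal = (ν univ).toReal - (ν (Ioi t)).toReal :=
    fun t => by
      rw [hdist, ENNReal.toReal_sub_of_le (measure_mono (subset_univ _)) (measure_ne_top _ _)]
  have hm1 : Measurable fun _ : ℝ => (1 : ℝ≥0∞) := measurable_const
  have key : ∀ t, b * x < t → (ν (Ioi t)).toReal = (ν univ).toReal - h t := fun t ht => by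
    refine measure_Ioi_toReal_eq (a := b * x) (h := fun t => (ν univ).toReal - h t)
      (fun t _ => measure_ne_top _ _) (continuousOn_const.sub hsm.continuousOn) ?_ ht
    intro t ht hcont
    have h1 := hF.toReal_eq_inverse one_pos hQ hD (x := x) (t := t) ht
      (measurable_convMeasure hm1 ν) (laplaceFinite_convMeasure hm1 laplaceFinite_one hν) (fun z hz => by
        rw [laplace_convMeasure hm1 hν, hL z hz, laplace_one hz, mul_comm]) (hbx.trans_lt ht) (by
        simp only [hreal]
        exact continuousAt_const.sub hcont)
    have h2 : (convMeasure (fun _ => 1) ν t).toReal = h t := by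
      simp only [h]
      rw [← h1]
      rfl
    rw [hreal] at h2
    linarith
  have hderiv : ∀ t, b * x < t → HasDerivAt h (deriv h t) t := fun t ht =>
    ((hsm.differentiableOn (by simp)).differentiableAt (Ioi_mem_nhds ht)).hasDerivAt
  refine ⟨deriv h, measurable_deriv h, hsm.continuousOn_deriv_of_isOpen isOpen_Ioi (by simp),
    fun c hc => ?_⟩
  exact restrict_eq_withDensity_of_hasDerivAt (h := fun t => h t - (ν univ).toReal)
    (hsm.continuousOn_deriv_of_isOpen isOpen_Ioi (by simp))
    (fun t ht => (hderiv t ht).sub_const _) (fun t ht => by rw [key t ht]; ring) hc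

/-- The density of `ν` beyond `b x` makes the convolution continuous at `t`; its transform is the
product `exp (-x F)` times the symbol of the tail, so inversion applies. -/
theorem convMeasure_levyTail_eq_inverse (hμ : IsLevyMeasure μ) (hF : IsWedgeExtension κ b F)
    (hFΦ : ∀ z : ℂ, 0 ≤ z.re → F z = bernsteinFn q b μ z) {x : ℝ} (hbx : 0 ≤ b * x)
    {ν : Measure ℝ} [IsFiniteMeasure ν] (hν : LaplaceFinite ν)
    (hL : ∀ z : ℂ, 0 < z.re → laplace ν z = Complex.exp (-(x * F z))) {t : ℝ} (ht : b * x < t) :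
    convMeasure (levyTail μ) ν t ≠ ∞ ∧ (convMeasure (levyTail μ) ν t).toReal =
      (hF.inverse 1 (tailSymbol F q b) (x, t)).re := by
  obtain ⟨k, hk, hkc, hνk⟩ := exists_density hF hbx hν hL
  have hm := IsLevyMeasure.measurable_levyTail μ
  obtain ⟨h1, h2⟩ := continuousAt_convMeasure_levyTail hμ hF hFΦ hν (hk.ennreal_ofReal) hbx
    (ENNReal.continuous_ofReal.comp_continuousOn hkc) (fun _ _ => ENNReal.ofReal_ne_top) hνk ht
  obtain ⟨D, hD⟩ := hF.tailSymbol_bound q one_pos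
  refine ⟨h1, ?_⟩
  have := hF.toReal_eq_inverse one_pos (hF.differentiableOn_tailSymbol q) hD (x := x) (t := t) ht
    (measurable_convMeasure hm ν) (laplaceFinite_convMeasure hm hμ.laplaceFinite_levyTail hν) (fun z hz => by
      rw [laplace_convMeasure hm hν, hL z hz, laplace_levyTail_eq_tailSymbol hμ hFΦ hz, mul_comm])
    (hbx.trans_lt ht) (continuousAt_toReal h1 h2)
  rw [← this]
  rfl

end Law

end InvSubord

end

/-! ### The theorem -/

theorem theorem3p11 {Ω : Type*} [MeasurableSpace Ω] (P : Measure Ω) [IsProbabilityMeasure P]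
    (σ : ℝ≥0 → Ω → ℝ≥0∞) (q b : ℝ) (hq : 0 ≤ q) (hb : 0 ≤ b)
    (μ : Measure ℝ) (hμ : InvSubord.IsLevyMeasure μ)
    (hσ : InvSubord.IsKilledSubordinator P σ q)
    (hΦ : InvSubord.HasLaplaceExponent P σ (InvSubord.bernsteinFn q b μ))
    (hB : InvSubord.HasSectorialExtension (InvSubord.bernsteinFn q b μ) b) :
    (∀ n : ℕ, 1 ≤ n →
      (∀ t : ℝ, 0 < t → InvSubord.convPow (InvSubord.levyTail μ) n t ≠ ∞) ∧
      ContDiffOn ℝ (⊤ : ℕ∞) (fun t => (InvSubord.convPow (InvSubord.levyTail μ) n t).toReal)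
        (Ioi (0 : ℝ))) ∧
    (∀ p ∈ InvSubord.region b, InvSubord.densityJump P σ b μ p.1 p.2 ≠ ∞) ∧
    ContDiffOn ℝ (⊤ : ℕ∞) (fun p : ℝ × ℝ => (InvSubord.densityJump P σ b μ p.1 p.2).toReal)
      (InvSubord.region b) := by
  obtain ⟨κ, F, hF, hFΦ⟩ := hB.exists_wedge
  obtain ⟨S, e, hS, he, hexp, hind, hσ⟩ := hσ
  -- Holomorphy of the exponent is inherited from `F`, with no differentiation under the integral
  -- against `μ`.
  have hd : DifferentiableOn ℂ (InvSubord.bernsteinFn q b μ) {z | 0 < z.re} :=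
    (hF.diff.mono fun z hz => InvSubord.mem_wedge_of_re_pos hF.pos.le hz).congr
      fun z hz => (hFΦ z (le_of_lt hz)).symm
  have hone : ∀ s : ℝ, 0 ≤ s → InvSubord.laplace (InvSubord.killedLaw P S q 1) s =
      Complex.exp (-InvSubord.bernsteinFn q b μ s) := fun s hs =>
    InvSubord.laplace_killedLaw_one hS he hexp hind hσ hΦ (by simpa using hs)
  -- On the region, `f_Φ` is the real part of one contour integral in `(x, t)`, so joint smoothness
  -- follows from that of the integral.
  have hjump : ∀ p ∈ InvSubord.region b, InvSubord.densityJump P σ b μ p.1 p.2 ≠ ∞ ∧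
      (InvSubord.densityJump P σ b μ p.1 p.2).toReal =
        (hF.inverse 1 (InvSubord.tailSymbol F q b) p).re := by
    rintro ⟨x, t⟩ hp
    have hx : 0 < x := hp.2.1
    rw [InvSubord.densityJump_eq hS he hexp hind hσ μ hp]
    refine InvSubord.convMeasure_levyTail_eq_inverse hμ hF hFΦ (mul_nonneg hb hx.le)
      (InvSubord.laplaceFinite_killedLaw hS q x.toNNReal) (fun z hz => ?_) hp.2.2
    rw [InvSubord.laplace_killedLaw_eq hS hone hd _ hz, hFΦ z hz.le, Real.coe_toNNReal x hx.le]
  refine ⟨fun n hn => ?_, fun p hp => (hjump p hp).1, ?_⟩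
  · obtain ⟨m, rfl⟩ := Nat.exists_eq_add_of_le' hn
    exact ⟨fun t ht => ((InvSubord.convPow_levyTail hμ hF hFΦ m).2.2.2 t ht).1,
      InvSubord.contDiffOn_convPow_levyTail hμ hF hFΦ m⟩
  · obtain ⟨D, hD⟩ := hF.tailSymbol_bound q one_pos
    have h := (hF.contDiffOn_inverse one_pos (hF.differentiableOn_tailSymbol q) hD).mono
      (fun p hp => hp.2.2 : InvSubord.region b ⊆ {p | b * p.1 < p.2})
    exact (Complex.reCLM.contDiff.comp_contDiffOn h).congr fun p hp => (hjump p hp).2
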